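/- Let $(G_i)_{i\in I}$ be a family of finite groups, indexed by an arbitrary set $I$, and let $G=\bigoplus_{i\in I}G_i$ be its restricted direct product, that is, the subgroup of $\prod_{i\in I}G_i$ consisting of those $(x_i)$ with $x_i=e_{G_i}$ for all but finitely many $i$. Let $\mathrm{Z}\ell^1(G)$ denote the centre of the convolution algebra $\ell^1(G)$ (complex coefficients, counting measure), equipped with the $\ell^1$-norm. A bounded approximate identity of norm $\le M$ for an ideal $J$ of $\mathrm{Z}\ell^1(G)$ is a net $(e_\alpha)$ in $J$ with $\|e_\alpha\|_1\le M$ for all $\alpha$ and $e_\alpha * a\to a$ in norm for every $a\in J$; $J$ has a bounded approximate identity if it has one of norm $\le M$ for some $M$. Then the following are equivalent: 1. every maximal ideal of $\mathrm{Z}\ell^1(G)$ has a bounded approximate identity; 2. there is a finite subset $F\subset I$ such that, for each $i\in I\setminus F$ and each irreducible group character $\chi$ of $G_i$ (the unnormalized trace of an irreducible finite-dimensional complex representation of $G_i$), we have $d_\chi\|\chi\|_1=|G_i|$, where $d_\chi=\chi(e)$ is the degree of $\chi$ and $\|\chi\|_1=\sum_{x\in G_i}|\chi(x)|$; 3. there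 exists a constant $M>0$ such that every maximal ideal of $\mathrm{Z}\ell^1(G)$ has a bounded approximate identity of norm $\le M$. -/

import Mathlib

open Filter Topology

universe u v

noncomputable section

/-- The restricted direct product `⨁ᵢ Gᵢ` of a family of groups: the subgroup of `∏ᵢ Gᵢ` of those
families `(xᵢ)` with `xᵢ = 1` for all but finitely many `i`. -/
def restrictedDirectProduct {ι : Type u} (G : ι → Type v) [∀ i, Group (G i)] :
    Subgroup (∀ i, G i) where
  carrier := {x | {i | x i ≠ 1}.Finite}
  one_mem' := by simp
  mul_mem' := by
    intro x y hx hy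
    refine (Set.Finite.union hx hy).subset ?_
    intro i hi
    by_contra h
    simp only [Set.mem_union, Set.mem_ofPred_eq, not_or, not_not] at h
    exact hi (by simp [h.1, h.2])
  inv_mem' := by
    intro x hx
    simpa using hx

/-- The Banach space `ℓ¹(G)` of absolutely summable functions `G → ℂ` (a type synonym, because
its multiplication below is convolution, not the pointwise product). -/
def EllOne (G : Type u) : Type u := lp (fun _ : G => ℂ) 1

namespace EllOne

section Space

variable {G : Type u}

instance instNormedAddCommGroup : NormedAddCommGroup (EllOne G) :=
  inferInstanceAs (NormedAddCommGroup (lp (fun _ : G => ℂ) 1))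

instance instNormedSpace : NormedSpace ℂ (EllOne G) :=
  inferInstanceAs (NormedSpace ℂ (lp (fun _ : G => ℂ) 1))

instance instCompleteSpace : CompleteSpace (EllOne G) :=
  inferInstanceAs (CompleteSpace (lp (fun _ : G => ℂ) 1))

/-- An element of `ℓ¹(G)` is a function on `G`. -/
instance instFunLike : FunLike (EllOne G) G ℂ where
  coe f := fun x => f.1 x
  coe_injective _ _ h := Subtype.ext h

@[ext] theorem ext {f g : EllOne G} (h : ∀ x, f x = g x) : f = g := DFunLike.ext _ _ h

@[simp] theorem add_apply (f g : EllOne G) (x : G) : (f + g) x = f x + g x := rfl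

@[simp] theorem zero_apply (x : G) : (0 : EllOne G) x = 0 := rfl

@[simp] theorem smul_apply (c : ℂ) (f : EllOne G) (x : G) : (c • f) x = c * f x := rfl

theorem summable_norm (f : EllOne G) : Summable fun x => ‖f x‖ := by
  have h := (lp.memℓp f).summable (by norm_num)
  simp only [ENNReal.toReal_one, Real.rpow_one] at h
  exact h

/-- The norm is `‖f‖₁ = ∑ₓ |f x|`. -/
theorem norm_eq_tsum (f : EllOne G) : ‖f‖ = ∑' x, ‖f x‖ := by
  have h := lp.norm_eq_tsum_rpow (p := 1) (by norm_num) f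
  simp only [ENNReal.toReal_one, Real.rpow_one, div_one] at h
  exact h

/-- An absolutely summable function, as an element of `ℓ¹(G)`. -/
def ofSummable (f : G → ℂ) (hf : Summable fun x => ‖f x‖) : EllOne G :=
  ⟨f, memℓp_gen (by simpa using hf)⟩

@[simp] theorem ofSummable_apply (f : G → ℂ) (hf : Summable fun x => ‖f x‖) (x : G) :
    ofSummable f hf x = f x := rfl

theorem norm_apply_le (f : EllOne G) (x : G) : ‖f x‖ ≤ ‖f‖ := by
  rw [norm_eq_tsum]
  exact f.summable_norm.le_tsum x fun _ _ => norm_nonneg _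

end Space

section Convolution

variable {G : Type u} [Group G]

/-- The change of variables `(y, x) ↦ (y, y⁻¹x)`. -/
def shear (G : Type u) [Group G] : G × G ≃ G × G where
  toFun p := (p.1, p.1⁻¹ * p.2)
  invFun p := (p.1, p.1 * p.2)
  left_inv p := by simp
  right_inv p := by simp

theorem hasSum_norm_mul (f g : EllOne G) :
    HasSum (fun p : G × G => ‖f p.1 * g (p.1⁻¹ * p.2)‖) (‖f‖ * ‖g‖) := by
  have h1 : Summable fun p : G × G => ‖f p.1‖ * ‖g p.2‖ :=
    f.summable_norm.mul_of_nonneg g.summable_norm (fun _ => norm_nonneg _) (fun _ => norm_nonneg _)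
  have h2 : HasSum (fun p : G × G => ‖f p.1‖ * ‖g p.2‖) (‖f‖ * ‖g‖) := by
    rw [norm_eq_tsum, norm_eq_tsum]
    exact f.summable_norm.hasSum.mul g.summable_norm.hasSum h1
  have h3 := (shear G).hasSum_iff.2 h2
  simpa [Function.comp_def, shear] using h3

theorem hasSum_norm_mul_swap (f g : EllOne G) :
    HasSum (fun p : G × G => ‖f p.2 * g (p.2⁻¹ * p.1)‖) (‖f‖ * ‖g‖) :=
  (Equiv.prodComm G G).hasSum_iff.2 (hasSum_norm_mul f g)

theorem summable_norm_mul (f g : EllOne G) (x : G) :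
    Summable fun y => ‖f y * g (y⁻¹ * x)‖ :=
  (hasSum_norm_mul_swap f g).summable.prod_factor x

theorem summable_mul (f g : EllOne G) (x : G) :
    Summable fun y => f y * g (y⁻¹ * x) := (summable_norm_mul f g x).of_norm

theorem summable_norm_tsum (f g : EllOne G) :
    Summable fun x => ‖∑' y, f y * g (y⁻¹ * x)‖ :=
  Summable.of_nonneg_of_le (fun _ => norm_nonneg _)
    (fun x => norm_tsum_le_tsum_norm (summable_norm_mul f g x))
    (hasSum_norm_mul_swap f g).summable.prod

/-- Convolution: `(f * g)(x) = ∑_y f(y) g(y⁻¹x)`. -/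
instance instMul : Mul (EllOne G) where
  mul f g := ofSummable (fun x => ∑' y, f y * g (y⁻¹ * x)) (summable_norm_tsum f g)

theorem mul_apply (f g : EllOne G) (x : G) : (f * g) x = ∑' y, f y * g (y⁻¹ * x) := rfl

open Classical in
/-- The unit is the point mass at the identity element. -/
instance instOne : One (EllOne G) where
  one := ofSummable (Pi.single 1 1) (by
    refine summable_of_ne_finset_zero (s := {1}) fun x hx => ?_
    have : x ≠ 1 := by simpa using hx
    simp [this])

open Classical in
theorem one_apply (x : G) : (1 : EllOne G) x = if x = 1 then 1 else 0 := by
  change (Pi.single 1 1 : G → ℂ) x = _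
  simp [Pi.single_apply]

theorem conv_norm_le (f g : EllOne G) : ‖f * g‖ ≤ ‖f‖ * ‖g‖ := by
  have h := hasSum_norm_mul_swap f g
  rw [norm_eq_tsum (f * g), ← h.tsum_eq, h.summable.tsum_prod]
  exact (summable_norm_tsum f g).tsum_le_tsum
    (fun x => norm_tsum_le_tsum_norm (summable_norm_mul f g x)) h.summable.prod

theorem conv_assoc (f g h : EllOne G) : f * g * h = f * (g * h) := by
  ext x
  have key : Summable fun p : G × G => f p.1 * g (p.1⁻¹ * p.2) * h (p.2⁻¹ * x) := by
    refine Summable.of_norm_bounded ((hasSum_norm_mul f g).summable.mul_right ‖h‖) fun p => ?_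
    rw [norm_mul]
    exact mul_le_mul_of_nonneg_left (h.norm_apply_le _) (norm_nonneg _)
  calc (f * g * h) x = ∑' z, ∑' y, f y * g (y⁻¹ * z) * h (z⁻¹ * x) := by
        rw [mul_apply]
        refine tsum_congr fun z => ?_
        rw [mul_apply, tsum_mul_right]
    _ = ∑' y, ∑' z, f y * g (y⁻¹ * z) * h (z⁻¹ * x) := key.tsum_comm
    _ = ∑' y, f y * (g * h) (y⁻¹ * x) := by
        refine tsum_congr fun y => ?_
        rw [mul_apply, ← tsum_mul_left, ← (Equiv.mulLeft y).tsum_eq]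
        refine tsum_congr fun w => ?_
        simp [mul_assoc]
    _ = (f * (g * h)) x := rfl

theorem conv_one (f : EllOne G) : f * 1 = f := by
  ext x
  rw [mul_apply, tsum_eq_single x]
  · simp [one_apply]
  · intro y hy
    have : ¬ y⁻¹ * x = 1 := fun h => hy (inv_mul_eq_one.1 h)
    simp [one_apply, this]

theorem one_conv (f : EllOne G) : 1 * f = f := by
  ext x
  rw [mul_apply, tsum_eq_single 1]
  · simp [one_apply]
  · intro y hy
    simp [one_apply, hy]

theorem conv_add (f g h : EllOne G) : f * (g + h) = f * g + f * h := by
  ext x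
  simp only [mul_apply, add_apply, mul_add]
  exact (summable_mul f g x).tsum_add (summable_mul f h x)

theorem add_conv (f g h : EllOne G) : (f + g) * h = f * h + g * h := by
  ext x
  simp only [mul_apply, add_apply, add_mul]
  exact (summable_mul f h x).tsum_add (summable_mul g h x)

theorem smul_conv (c : ℂ) (f g : EllOne G) : c • f * g = c • (f * g) := by
  ext x
  simp only [mul_apply, smul_apply, mul_assoc, tsum_mul_left]

theorem conv_smul (c : ℂ) (f g : EllOne G) : f * c • g = c • (f * g) := by
  ext x
  simp only [mul_apply, smul_apply, mul_left_comm, tsum_mul_left]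

/-- `ℓ¹(G)` is a Banach algebra under convolution and the `ℓ¹`-norm. -/
instance instNormedRing : NormedRing (EllOne G) where
  __ := instNormedAddCommGroup (G := G)
  mul_assoc := conv_assoc
  one_mul := one_conv
  mul_one := conv_one
  left_distrib := conv_add
  right_distrib := add_conv
  zero_mul f := by ext x; simp [mul_apply]
  mul_zero f := by ext x; simp [mul_apply]
  norm_mul_le := conv_norm_le

instance instNormedAlgebra : NormedAlgebra ℂ (EllOne G) where
  __ := Algebra.ofModule (R := ℂ) (A := EllOne G) smul_conv fun c f g => conv_smul c f g
  norm_smul_le c f := norm_smul_le c f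

end Convolution

end EllOne

/-- `Zℓ¹(G)`, the centre of the convolution algebra `ℓ¹(G)`, with the `ℓ¹`-norm. -/
abbrev ZEllOne (G : Type u) [Group G] : Subalgebra ℂ (EllOne G) :=
  Subalgebra.center ℂ (EllOne G)

/-- The ideal `I` has a bounded approximate identity of norm at most `M`: there is a net in
`I`, with all terms of norm at most `M`, such that `e * a → a` and `a * e → a` along the net for
every `a ∈ I`. The net is given by the (proper) filter of its tails. -/
def HasBAIOfNormLE {A : Type u} [NormedRing A] (I : Ideal A) (M : ℝ) : Prop :=
  ∃ l : Filter A, l.NeBot ∧ (∀ᶠ e in l, e ∈ I ∧ ‖e‖ ≤ M) ∧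
    ∀ a ∈ I, Tendsto (fun e => e * a) l (𝓝 a) ∧ Tendsto (fun e => a * e) l (𝓝 a)

/-- The ideal `I` has a bounded approximate identity. -/
def HasBAI {A : Type u} [NormedRing A] (I : Ideal A) : Prop :=
  ∃ M : ℝ, HasBAIOfNormLE I M

/-- `χ` is an irreducible group character of degree `d`: the (unnormalized) trace of an irreducible
complex representation of dimension `d`. -/
def IsIrreducibleCharacter {G : Type u} [Group G] (d : ℕ) (χ : G → ℂ) : Prop :=
  ∃ π : Representation ℂ G (Fin d → ℂ), π.IsIrreducible ∧ χ = π.character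

end

/-! The equivalence rests on a description of the characters of `Zℓ¹(G)`, `G = ⨁ Gᵢ`, in terms of
normalised irreducible characters `φ = χ / χ(1)` of finite groups. These are exactly the functions
with `φ 1 = 1` and `avg_g φ (g x g⁻¹ y) = φ x * φ y` (`IsSpherical`). For such a `φ`, write
`N = ∑ |φ|²`; then `e_φ = conj φ / N` is the minimal central idempotent belonging to `φ`, its
`ℓ¹`-norm is `∑ |φ| / N`, and the condition `d_χ ‖χ‖₁ = |Gᵢ|` says that this norm is `1`.

*Bounded idempotents give approximate identities.* A maximal ideal of `Zℓ¹(G)` is the kernel of a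
character `ω`. For finite `T ⊆ ι`, `ω` restricts to a normalised irreducible character of
`∏_{i ∈ T} Gᵢ`, which is a product of normalised irreducible characters of the factors, so the norm
of its idempotent `e_T` is a product of norms on the factors. If almost all of these are `1`, the
`e_T` are bounded independently of `ω`, and `1 - e_T` is an approximate identity of `ker ω`, since
`e_T * a → 0` when `ω a = 0` (`hasBAIOfNormLE_ker`).

*Approximate identities bound idempotents.* Conversely, normalised irreducible characters `φᵢ` of
the factors multiply to a character `ω` of `Zℓ¹(G)` (`prodChar`). Let `u` be a term of an approximate
identity of `ker ω` of bound `M`, with `u * (1 - e_T)` close to `1 - e_T`. Then `e_T * (1 - u)` is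
close to `1 - u`, so its norm is at most `M + 2`; pairing it with a suitable bounded product function
shows that its norm is at least `‖e_T‖` (`DirectFactor.mul_norm_pairing_le`). Hence the
products `∏_{i ∈ T} ‖e_{φᵢ}‖` are bounded.

*The gap.* That only finitely many factors of this product can exceed `1` follows from Rider's gap
theorem `IsSpherical.sum_norm_eq_or_le`: `‖e_φ‖` is either `1` or at least `1 + 1/800`. If `‖e_φ‖` is
smaller than this, then `|φ|` carries almost all its mass where it is close to `1`. The defect
`√(1 - |φ|²)` is subadditive, and a counting argument shows that the set `H` on which it is small is
a normal subgroup. The normalised restriction of `φ` to `H` is an idempotent of `ℂ[H]`, and the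
integrality of its trace forces `|φ| = 1` on `H`. Finally `e_φ` and the idempotent
`conj φ 1_H / |H|` are commuting idempotents at distance less than `1`, so they coincide, and
`‖e_φ‖ = 1`. -/

/-! ### Normalised irreducible characters -/

noncomputable section

/-- A normalised irreducible character of a finite group, described without representations: a
function `φ` with `φ 1 = 1` whose averages satisfy the functional equation
`avg_g φ (g x g⁻¹ y) = φ x * φ y`. -/
structure IsSpherical {K : Type*} [Group K] [Fintype K] (φ : K → ℂ) : Prop where
  map_one : φ 1 = 1
  sum_conj : ∀ x y, ∑ g, φ (g * x * g⁻¹ * y) = Fintype.card K * (φ x * φ y)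

/-- The squared `ℓ²`-norm of a function on a finite group. -/
def sumSq {K : Type*} [Fintype K] (φ : K → ℂ) : ℝ := ∑ x, ‖φ x‖ ^ 2

theorem ofReal_sumSq {K : Type*} [Fintype K] (φ : K → ℂ) :
    (sumSq φ : ℂ) = ∑ x, φ x * (starRingEnd ℂ) (φ x) := by
  simp [sumSq, Complex.mul_conj, Complex.normSq_eq_norm_sq]

/-- For a normalised irreducible character `φ`, the sine of the angle between `φ (x * ·)` and `φ`
in `ℓ²(K)`; it measures how far a representation affording `φ` is from being scalar at `x`. -/
def defect {K : Type*} (φ : K → ℂ) (x : K) : ℝ := √(1 - ‖φ x‖ ^ 2)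

theorem defect_nonneg {K : Type*} (φ : K → ℂ) (x : K) : 0 ≤ defect φ x := Real.sqrt_nonneg _

namespace IsSpherical

open ComplexConjugate

variable {K : Type*} [Group K] [Fintype K] {φ ψ : K → ℂ}

theorem apply_conj (hφ : IsSpherical φ) (h x : K) : φ (h * x * h⁻¹) = φ x := by
  have key : ∑ g, φ (g * (h * x * h⁻¹) * g⁻¹ * 1) = ∑ g, φ (g * x * g⁻¹ * 1) := by
    rw [← Equiv.sum_comp (Equiv.mulRight h) (fun g => φ (g * x * g⁻¹ * 1))]
    refine Finset.sum_congr rfl fun g _ => ?_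
    simp [mul_assoc]
  have hK : (Fintype.card K : ℂ) ≠ 0 := by simp
  rw [hφ.sum_conj, hφ.sum_conj, hφ.map_one] at key
  simpa using mul_left_cancel₀ hK key

theorem apply_mul_comm (hφ : IsSpherical φ) (x y : K) : φ (x * y) = φ (y * x) := by
  have := hφ.apply_conj x (y * x)
  rw [← this]
  congr 1
  group

/-- Class functions act on `φ` by translations as scalars. -/
theorem sum_mul_apply_mul (hφ : IsSpherical φ) {w : K → ℂ} (hw : ∀ g h, w (g * h * g⁻¹) = w h)
    (x : K) : ∑ h, w h * φ (h * x) = (∑ h, w h * φ h) * φ x := by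
  have hK : (Fintype.card K : ℂ) ≠ 0 := by simp
  have h1 : ∀ g : K, ∑ h, w h * φ (h * x) = ∑ h, w h * φ (g * h * g⁻¹ * x) := by
    intro g
    rw [← (MulAut.conj g).toEquiv.sum_comp (fun h => w h * φ (h * x))]
    refine Finset.sum_congr rfl fun h _ => ?_
    simp [hw]
  have h2 : (Fintype.card K : ℂ) * ∑ h, w h * φ (h * x)
      = ∑ g : K, ∑ h, w h * φ (g * h * g⁻¹ * x) := by
    rw [← Finset.sum_congr rfl fun g _ => h1 g]
    simp
  apply mul_left_cancel₀ hK
  rw [h2, Finset.sum_comm, Finset.sum_mul, Finset.mul_sum]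
  refine Finset.sum_congr rfl fun h _ => ?_
  rw [← Finset.mul_sum, hφ.sum_conj]
  ring

theorem apply_inv_conj (hφ : IsSpherical φ) (g h : K) : φ (g * h * g⁻¹)⁻¹ = φ h⁻¹ := by
  rw [← hφ.apply_conj g h⁻¹]
  congr 1
  group

/-- Orthogonality of distinct normalised irreducible characters. -/
theorem eq_of_sum_ne_zero (hφ : IsSpherical φ) (hψ : IsSpherical ψ)
    (h : ∑ x, φ x * ψ x⁻¹ ≠ 0) : φ = ψ := by
  funext y
  have h1 := hφ.sum_mul_apply_mul (w := fun h => ψ h⁻¹) hψ.apply_inv_conj y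
  have h2 := hψ.sum_mul_apply_mul (w := fun h => φ h⁻¹) hφ.apply_inv_conj y
  have h3 : ∑ h, φ h⁻¹ * ψ h = ∑ h, ψ h⁻¹ * φ h := by
    rw [← Equiv.sum_comp (Equiv.inv K) (fun h => ψ h⁻¹ * φ h)]
    simp [mul_comm]
  have h4 : ∑ h, φ h⁻¹ * ψ (h * y) = ∑ h, ψ h⁻¹ * φ (h * y) := by
    rw [← Equiv.sum_comp ((Equiv.mulRight y).trans (Equiv.inv K)) (fun h => ψ h⁻¹ * φ (h * y))]
    refine Finset.sum_congr rfl fun h _ => ?_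
    have : φ (y⁻¹ * h⁻¹ * y) = φ h⁻¹ := by simpa using hφ.apply_conj y⁻¹ h⁻¹
    simp [this, mul_comm (φ _)]
  rw [h1, h2, h3] at h4
  refine (mul_left_cancel₀ ?_ h4).symm
  simpa only [mul_comm] using h

theorem sumSq_pos (hφ : IsSpherical φ) : 0 < sumSq φ :=
  Finset.sum_pos' (fun _ _ => by positivity) ⟨1, Finset.mem_univ _, by simp [hφ.map_one]⟩

theorem star_inv (hφ : IsSpherical φ) : IsSpherical fun x => conj (φ x⁻¹) where
  map_one := by simp [hφ.map_one]
  sum_conj x y := by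
    rw [← hφ.apply_conj x x⁻¹]
    have : ∀ g : K, φ (g * x * g⁻¹ * y)⁻¹ = φ (g * x⁻¹ * g⁻¹ * y⁻¹) := fun g => by
      rw [hφ.apply_mul_comm]
      congr 1
      group
    simp only [this, ← map_sum, hφ.sum_conj]
    simp

/-- A normalised irreducible character is Hermitian: otherwise it would be orthogonal to
`x ↦ conj (φ x⁻¹)`, but their pairing is `∑ |φ|² > 0`. -/
theorem apply_inv (hφ : IsSpherical φ) (x : K) : φ x⁻¹ = conj (φ x) := by
  have h : φ = fun x => conj (φ x⁻¹) := by
    refine hφ.eq_of_sum_ne_zero hφ.star_inv ?_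
    simp only [inv_inv, ← ofReal_sumSq]
    exact_mod_cast hφ.sumSq_pos.ne'
  have := congrFun h x⁻¹
  simpa using this

theorem sum_conj_mul (hφ : IsSpherical φ) (x : K) :
    ∑ h, conj (φ h) * φ (h * x) = sumSq φ * φ x := by
  rw [hφ.sum_mul_apply_mul (w := fun h => conj (φ h)) (by simp [hφ.apply_conj]), ofReal_sumSq]
  simp only [mul_comm]

theorem sum_mul_apply_inv_mul (hφ : IsSpherical φ) (x : K) :
    ∑ h, φ h * φ (h⁻¹ * x) = sumSq φ * φ x := by
  rw [← hφ.sum_conj_mul x, ← Equiv.sum_comp (Equiv.inv K)]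
  simp [hφ.apply_inv]

/-- The squared distance in `ℓ²(K)` from the translate `φ (x * ·)` to `c * φ`; it is smallest for
`c = φ x`. -/
theorem sum_norm_sub_sq (hφ : IsSpherical φ) (c : ℂ) (x : K) :
    ∑ z, ‖φ (x * z) - c * φ z‖ ^ 2 = sumSq φ * (1 - ‖φ x‖ ^ 2 + ‖φ x - c‖ ^ 2) := by
  have e1 : ∑ z, φ (x * z) * conj (φ (x * z)) = sumSq φ := by
    rw [ofReal_sumSq, ← Equiv.sum_comp (Equiv.mulLeft x) (fun z => φ z * conj (φ z))]
    rfl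
  have e2 : ∑ z, conj (φ z) * φ (x * z) = sumSq φ * φ x := by
    rw [← hφ.sum_conj_mul]
    simp only [hφ.apply_mul_comm x]
  have e3 : ∑ z, φ z * conj (φ (x * z)) = sumSq φ * conj (φ x) := by
    have := congrArg conj e2
    simpa using this
  have sq : ∀ z : ℂ, ((‖z‖ ^ 2 : ℝ) : ℂ) = z * conj z := fun z => by
    rw [Complex.mul_conj, Complex.normSq_eq_norm_sq]
  apply Complex.ofReal_injective
  push_cast [-Complex.ofReal_pow]
  simp only [sq]
  calc _ = ∑ z, (φ (x * z) * conj (φ (x * z)) - conj c * (conj (φ z) * φ (x * z))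
        - c * (φ z * conj (φ (x * z))) + c * conj c * (φ z * conj (φ z))) := by
        refine Finset.sum_congr rfl fun z _ => ?_
        simp only [map_sub, map_mul]
        ring
    _ = _ := by
        simp only [Finset.sum_add_distrib, Finset.sum_sub_distrib, ← Finset.mul_sum, e1, e2, e3,
          ← ofReal_sumSq, map_sub]
        ring

theorem norm_le_one (hφ : IsSpherical φ) (x : K) : ‖φ x‖ ≤ 1 := by
  have h := hφ.sum_norm_sub_sq (φ x) x
  have h0 : 0 ≤ ∑ z, ‖φ (x * z) - φ x * φ z‖ ^ 2 := Finset.sum_nonneg fun _ _ => by positivity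
  rw [h] at h0
  have := (mul_nonneg_iff_of_pos_left hφ.sumSq_pos).1 h0
  simp at this
  exact this

theorem sumSq_le_sum_norm (hφ : IsSpherical φ) : sumSq φ ≤ ∑ x, ‖φ x‖ :=
  Finset.sum_le_sum fun x _ => by
    have := hφ.norm_le_one x
    nlinarith [norm_nonneg (φ x)]

theorem defect_sq (hφ : IsSpherical φ) (x : K) : defect φ x ^ 2 = 1 - ‖φ x‖ ^ 2 := by
  have := hφ.norm_le_one x
  exact Real.sq_sqrt (by nlinarith [norm_nonneg (φ x)])

theorem defect_inv (hφ : IsSpherical φ) (x : K) : defect φ x⁻¹ = defect φ x := by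
  simp [defect, hφ.apply_inv]

theorem defect_conj (hφ : IsSpherical φ) (g x : K) : defect φ (g * x * g⁻¹) = defect φ x := by
  simp [defect, hφ.apply_conj]

/-- The defect is subadditive, by the triangle inequality in `ℓ²(K)`. -/
theorem defect_mul_le (hφ : IsSpherical φ) (x y : K) :
    defect φ (x * y) ≤ defect φ x + defect φ y := by
  have hN := hφ.sumSq_pos
  let V : K → EuclideanSpace ℂ K := fun x => WithLp.toLp 2 fun z => φ (x * z)
  have hV : ∀ x c, ‖V x - c • V 1‖ = √(sumSq φ) * √(1 - ‖φ x‖ ^ 2 + ‖φ x - c‖ ^ 2) := by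
    intro x c
    rw [EuclideanSpace.norm_eq, ← Real.sqrt_mul hN.le, ← hφ.sum_norm_sub_sq]
    simp [V]
  have h1 : √(sumSq φ) * defect φ (x * y) ≤ ‖V (x * y) - (φ x * φ y) • V 1‖ := by
    rw [hV]
    exact mul_le_mul_of_nonneg_left (Real.sqrt_le_sqrt (by simp)) (Real.sqrt_nonneg _)
  have h2 : ‖V (x * y) - φ x • V y‖ = √(sumSq φ) * defect φ x := by
    have := hV x (φ x)
    simp only [sub_self, norm_zero, ne_eq, OfNat.ofNat_ne_zero, not_false_eq_true, zero_pow,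
      add_zero] at this
    rw [defect, ← this, EuclideanSpace.norm_eq, EuclideanSpace.norm_eq,
      ← Equiv.sum_comp (Equiv.mulLeft y) (fun z => ‖(V x - φ x • V 1) z‖ ^ 2)]
    simp [V, mul_assoc]
  have h3 : ‖φ x • (V y - φ y • V 1)‖ ≤ √(sumSq φ) * defect φ y := by
    have := hV y (φ y)
    simp only [sub_self, norm_zero, ne_eq, OfNat.ofNat_ne_zero, not_false_eq_true, zero_pow,
      add_zero] at this
    rw [defect, ← this, norm_smul]
    exact mul_le_of_le_one_left (norm_nonneg _) (hφ.norm_le_one x)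
  have h4 : V (x * y) - (φ x * φ y) • V 1
      = (V (x * y) - φ x • V y) + φ x • (V y - φ y • V 1) := by
    rw [smul_sub, smul_smul]
    abel
  have h5 := norm_add_le (V (x * y) - φ x • V y) (φ x • (V y - φ y • V 1))
  rw [← h4, h2] at h5
  refine le_of_mul_le_mul_left ?_ (Real.sqrt_pos.2 hN)
  rw [mul_add]
  exact h1.trans (h5.trans (by gcongr))

end IsSpherical
end

/-! ### The gap theorem for minimal central idempotents -/

noncomputable section

namespace IsSpherical

open ComplexConjugate Finset

variable {K : Type*} [Group K] [Fintype K] {φ ψ : K → ℂ}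

open Classical in
/-- The normalised restriction of `conj φ` to a normal subgroup acts on `φ` as the identity. -/
theorem sum_subgroup_mul (hφ : IsSpherical φ) (H : Subgroup K) [H.Normal] (x : K) :
    ∑ h, (if h ∈ H then conj (φ h) else 0) * φ (h * x)
      = ((∑ h : H, ‖φ h‖ ^ 2 : ℝ) : ℂ) * φ x := by
  rw [hφ.sum_mul_apply_mul]
  · congr 1
    have h1 : ∀ h, (if h ∈ H then conj (φ h) else 0) * φ h
        = if h ∈ H then ((‖φ h‖ ^ 2 : ℝ) : ℂ) else 0 := by
      intro h
      split_ifs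
      · rw [mul_comm, Complex.mul_conj, Complex.normSq_eq_norm_sq]
      · simp
    rw [Finset.sum_congr rfl fun h _ => h1 h, ← Finset.sum_filter,
      Finset.sum_subtype (p := fun h => h ∈ H) _ (by simp)]
    push_cast
    rfl
  · intro g h
    have : g * h * g⁻¹ ∈ H ↔ h ∈ H :=
      ⟨fun hh => by simpa [mul_assoc] using Subgroup.Normal.conj_mem ‹_› _ hh g⁻¹,
        fun hh => Subgroup.Normal.conj_mem ‹_› _ hh g⟩
    simp [this, hφ.apply_conj]

/-- If `|φ|² > 1/2` throughout a normal subgroup `H`, then `|φ| = 1` there: the normalised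
restriction of `φ` to `H` is a convolution idempotent, and the trace `|H| / ∑_H |φ|²` of the
associated projection of `ℂ^H` is an integer in `[1, 2)`. -/
theorem norm_eq_one_of_normal (hφ : IsSpherical φ) (H : Subgroup K) [H.Normal]
    (hH : ∀ x ∈ H, 1 / 2 < ‖φ x‖ ^ 2) : ∀ x ∈ H, ‖φ x‖ = 1 := by
  classical
  set N : ℝ := ∑ h : H, ‖φ h‖ ^ 2 with hN
  have hNpos : 0 < N :=
    Finset.sum_pos' (fun _ _ => by positivity) ⟨1, Finset.mem_univ _, by simp [hφ.map_one]⟩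
  have hNC : (N : ℂ) ≠ 0 := by exact_mod_cast hNpos.ne'
  have hle : ∀ h : H, ‖φ h‖ ^ 2 ≤ 1 := fun h => pow_le_one₀ (norm_nonneg _) (hφ.norm_le_one _)
  have hlow : (Fintype.card H : ℝ) < 2 * N := by
    have : ∑ _h : H, (1 / 2 : ℝ) < N :=
      Finset.sum_lt_sum_of_nonempty ⟨1, Finset.mem_univ _⟩ fun h _ => hH h h.2
    simp at this
    linarith
  -- the matrix of convolution with the normalised restriction of `φ`
  let P : Matrix H H ℂ := Matrix.of fun x y => φ (x * (y : K)⁻¹) / N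
  have hP : P * P = P := by
    ext x y
    have h1 := hφ.sum_subgroup_mul H (x * (y : K)⁻¹)
    rw [← Finset.sum_filter_of_ne (p := fun h => h ∈ H)
      (fun h _ hh => by by_contra hc; simp [hc] at hh),
      Finset.sum_subtype (p := fun h => h ∈ H) _ (by simp), ← hN,
      ← Equiv.sum_comp (Equiv.mulRight x⁻¹)] at h1
    simp only [Matrix.mul_apply, P, Matrix.of_apply, div_mul_div_comm, ← Finset.sum_div]
    rw [div_eq_div_iff (mul_ne_zero hNC hNC) hNC]
    have h2 : ∀ z : H, φ (x * (z : K)⁻¹) * φ (z * (y : K)⁻¹)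
        = (if ((Equiv.mulRight x⁻¹ z : H) : K) ∈ H then conj (φ (Equiv.mulRight x⁻¹ z : H)) else 0)
          * φ ((Equiv.mulRight x⁻¹ z : H) * (x * (y : K)⁻¹)) := by
      intro z
      rw [if_pos (SetLike.coe_mem _), ← hφ.apply_inv]
      simp [mul_assoc]
    rw [Finset.sum_congr rfl fun z _ => h2 z, h1]
    ring
  have hidem : IsIdempotentElem (Matrix.toLin' P) := by
    rw [IsIdempotentElem, Module.End.mul_eq_comp, ← Matrix.toLin'_mul, hP]
  have htr := (LinearMap.IsIdempotentElem.isProj_range _ hidem).trace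
  rw [Matrix.trace_toLin'_eq] at htr
  have htr' : P.trace = ((Fintype.card H / N : ℝ) : ℂ) := by
    simp [Matrix.trace, P, hφ.map_one, div_eq_mul_inv]
  rw [htr'] at htr
  set m := Module.finrank ℂ (LinearMap.range (Matrix.toLin' P))
  have hm : (Fintype.card H : ℝ) = m * N := by
    have : (Fintype.card H / N : ℝ) = m := by exact_mod_cast htr
    rw [← this]
    field_simp
  have hm1 : m = 1 := by
    have h0 : (0 : ℝ) < Fintype.card H := by exact_mod_cast Fintype.card_pos
    have h2 : (m : ℝ) < 2 := by
      by_contra hc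
      push Not at hc
      nlinarith
    have h3 : m < 2 := by exact_mod_cast h2
    have h4 : m ≠ 0 := fun hc => by simp [hc] at hm
    omega
  have hsum : ∑ h : H, ‖φ h‖ ^ 2 = ∑ _h : H, (1 : ℝ) := by
    rw [← hN]
    simp [hm, hm1]
  have := (Finset.sum_eq_sum_iff_of_le fun h _ => hle h).1 hsum
  intro x hx
  have h1 := this ⟨x, hx⟩ (Finset.mem_univ _)
  exact (pow_eq_one_iff_of_nonneg (norm_nonneg _) two_ne_zero).1 h1

end IsSpherical

/-- A convolution idempotent of `ℓ¹`-norm less than one vanishes. -/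
theorem eq_zero_of_convolution_idempotent {K : Type*} [Group K] [Fintype K] {F : K → ℂ}
    (hF : ∀ x, ∑ h, F h * F (h⁻¹ * x) = F x) (h1 : ∑ x, ‖F x‖ < 1) : F = 0 := by
  obtain ⟨a, ha⟩ := Finite.exists_max fun x => ‖F x‖
  have h2 : ‖F a‖ ≤ (∑ x, ‖F x‖) * ‖F a‖ := by
    conv_lhs => rw [← hF a]
    rw [Finset.sum_mul]
    refine norm_sum_le_of_le _ fun h _ => ?_
    rw [norm_mul]
    exact mul_le_mul_of_nonneg_left (ha _) (norm_nonneg _)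
  have h3 : ‖F a‖ = 0 := by
    by_contra hc
    have : 0 < ‖F a‖ := lt_of_le_of_ne (norm_nonneg _) (Ne.symm hc)
    nlinarith
  funext x
  exact norm_le_zero_iff.1 ((ha x).trans h3.le)

namespace IsSpherical

open ComplexConjugate Finset

variable {K : Type*} [Group K] [Fintype K] {φ ψ : K → ℂ}

open Classical in
/-- If `φ` is close in `ℓ¹` to a unimodular function on a normal subgroup, then it vanishes off
that subgroup, because the two corresponding central idempotents are at distance less than one. -/
theorem sum_norm_eq_sumSq_of_normal (hφ : IsSpherical φ) (H : Subgroup K) [H.Normal]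
    (hH : ∀ x ∈ H, ‖φ x‖ = 1) (hN : 3 / 4 * sumSq φ ≤ Fintype.card H)
    (hoff : ∑ x with x ∉ H, ‖φ x‖ ≤ sumSq φ / 4) : ∑ x, ‖φ x‖ = sumSq φ := by
  set N := sumSq φ with hNdef
  set n : ℝ := (Fintype.card H : ℝ) with hn
  have hNpos : 0 < N := hφ.sumSq_pos
  have hnpos : 0 < n := by rw [hn]; exact_mod_cast Fintype.card_pos
  have hNC : (N : ℂ) ≠ 0 := by exact_mod_cast hNpos.ne'
  have hnC : (n : ℂ) ≠ 0 := by exact_mod_cast hnpos.ne'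
  have hcard : (#{x | x ∈ H} : ℝ) = n := by rw [hn, Fintype.card_subtype]
  have hnN : n ≤ N := by
    rw [← hcard, hNdef, sumSq, ← Finset.sum_filter_add_sum_filter_not _ (fun x => x ∈ H)]
    have : ∑ x with x ∈ H, ‖φ x‖ ^ 2 = ∑ x with x ∈ H, 1 :=
      Finset.sum_congr rfl fun x hx => by simp [hH x (by simpa using hx)]
    rw [this]
    simp only [Finset.sum_const, nsmul_eq_mul, mul_one]
    exact le_add_of_nonneg_right (Finset.sum_nonneg fun _ _ => by positivity)
  have hNH : ((∑ h : H, ‖φ h‖ ^ 2 : ℝ) : ℂ) = n := by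
    have : ∑ h : H, ‖φ h‖ ^ 2 = n := by
      rw [Finset.sum_congr rfl fun h _ => by rw [hH h h.2, one_pow]]
      simp [hn]
    rw [this]
  -- the difference of the idempotents `φ 1_H / |H|` and `φ / N`
  let F : K → ℂ := fun x => (if x ∈ H then φ x / n else 0) - φ x / N
  have hinv : ∀ h, (if h⁻¹ ∈ H then conj (φ h⁻¹) else 0) = if h ∈ H then φ h else 0 := by
    intro h
    simp [hφ.apply_inv]
  have c1 : ∀ x, ∑ h, (if h ∈ H then φ h else 0) * φ (h⁻¹ * x) = n * φ x := by
    intro x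
    rw [← hNH, ← hφ.sum_subgroup_mul H x,
      ← Equiv.sum_comp (Equiv.inv K) (fun h => (if h ∈ H then conj (φ h) else 0) * φ (h * x))]
    simp only [Equiv.inv_apply, hinv]
  have c2 : ∀ x, ∑ h, φ h * (if h⁻¹ * x ∈ H then φ (h⁻¹ * x) else 0) = n * φ x := by
    intro x
    rw [← c1 x, ← Equiv.sum_comp ((Equiv.inv K).trans (Equiv.mulLeft x))]
    refine Finset.sum_congr rfl fun h _ => ?_
    have : (x * h⁻¹)⁻¹ * x = h := by group
    simp only [Equiv.trans_apply, Equiv.inv_apply, Equiv.coe_mulLeft, this]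
    rw [hφ.apply_mul_comm x, mul_comm]
  have c3 := hφ.sum_mul_apply_inv_mul
  have c4 : ∀ x, ∑ h, (if h ∈ H then φ h else 0) * (if h⁻¹ * x ∈ H then φ (h⁻¹ * x) else 0)
      = n * if x ∈ H then φ x else 0 := by
    intro x
    split_ifs with hx
    · rw [← c1 x]
      refine Finset.sum_congr rfl fun h _ => ?_
      by_cases hh : h ∈ H
      · rw [if_pos (H.mul_mem (H.inv_mem hh) hx)]
      · simp [hh]
    · rw [mul_zero]
      refine Finset.sum_eq_zero fun h _ => ?_
      by_cases hh : h ∈ H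
      · rw [if_neg (fun hc : h⁻¹ * x ∈ H => hx ((H.mul_mem_cancel_left (H.inv_mem hh)).1 hc)),
          mul_zero]
      · rw [if_neg hh, zero_mul]
  have hF : ∀ x, ∑ h, F h * F (h⁻¹ * x) = F x := by
    intro x
    have e : ∀ h, F h * F (h⁻¹ * x)
        = ((if h ∈ H then φ h else 0) * (if h⁻¹ * x ∈ H then φ (h⁻¹ * x) else 0)) / (n * n)
        - ((if h ∈ H then φ h else 0) * φ (h⁻¹ * x)) / (n * N)
        - (φ h * (if h⁻¹ * x ∈ H then φ (h⁻¹ * x) else 0)) / (n * N)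
        + (φ h * φ (h⁻¹ * x)) / (N * N) := by
      intro h
      simp only [F]
      split_ifs <;> field_simp <;> ring
    rw [Finset.sum_congr rfl fun h _ => e h]
    simp only [Finset.sum_add_distrib, Finset.sum_sub_distrib, ← Finset.sum_div, c1, c2, c3, c4, F]
    split_ifs <;> field_simp <;> ring
  -- both the part of `F` on `H` and the part off `H` have norm at most `1/4`
  have hF1 : ∑ x, ‖F x‖ < 1 := by
    rw [← Finset.sum_filter_add_sum_filter_not _ (fun x => x ∈ H)]
    have h1 : ∑ x with x ∈ H, ‖F x‖ = n * (1 / n - 1 / N) := by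
      rw [← hcard, ← nsmul_eq_mul, ← Finset.sum_const]
      refine Finset.sum_congr rfl fun x hx => ?_
      have hx' : x ∈ H := by simpa using hx
      have : F x = φ x * ((1 / n - 1 / N : ℝ) : ℂ) := by
        simp only [F, if_pos hx']
        push_cast
        ring
      rw [this, norm_mul, hH x hx', one_mul, Complex.norm_real, Real.norm_of_nonneg]
      · rw [hcard]
      · exact sub_nonneg.2 (one_div_le_one_div_of_le hnpos hnN)
    have h2 : ∑ x with x ∉ H, ‖F x‖ = (∑ x with x ∉ H, ‖φ x‖) / N := by
      rw [Finset.sum_div]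
      refine Finset.sum_congr rfl fun x hx => ?_
      have hx' : x ∉ H := by simpa using hx
      simp [F, hx', abs_of_pos hNpos]
    have h3 : n * (1 / n - 1 / N) ≤ 1 / 4 := by
      have : n * (1 / n - 1 / N) = 1 - n / N := by field_simp
      rw [this]
      have : 3 / 4 ≤ n / N := (le_div_iff₀ hNpos).2 hN
      linarith
    have h4 : (∑ x with x ∉ H, ‖φ x‖) / N ≤ 1 / 4 := by
      rw [div_le_iff₀ hNpos]
      linarith
    rw [h1, h2]
    linarith
  have hF0 := eq_zero_of_convolution_idempotent hF hF1
  have hnN' : n = N := by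
    have h1 := congrFun hF0 1
    simp only [F, one_mem, if_true, hφ.map_one, Pi.zero_apply, sub_eq_zero] at h1
    rw [div_eq_div_iff hnC hNC, one_mul, one_mul] at h1
    exact_mod_cast h1.symm
  rw [← hnN', ← hcard, ← nsmul_one, ← Finset.sum_const, Finset.sum_filter]
  refine Finset.sum_congr rfl fun x _ => ?_
  split_ifs with hx
  · exact hH x hx
  · have h1 := congrFun hF0 x
    simpa [F, hx, hNC] using h1

/-- **Gap theorem** (Rider): the `ℓ¹`-norm of a minimal central idempotent of a finite group
algebra is either `1` or at least `1 + 1 / 800`. -/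
theorem sum_norm_eq_or_le (hφ : IsSpherical φ) :
    ∑ x, ‖φ x‖ = sumSq φ ∨ (1 + 1 / 800) * sumSq φ ≤ ∑ x, ‖φ x‖ := by
  classical
  refine or_iff_not_imp_right.2 fun hlt => ?_
  push Not at hlt
  have hNpos := hφ.sumSq_pos
  have hn1 := hφ.norm_le_one
  have hn0 : ∀ x, 0 ≤ ‖φ x‖ := fun x => norm_nonneg _
  have hdef := hφ.defect_sq
  have hd0 := defect_nonneg φ
  -- `|φ|` has little mass where it is not close to `1`
  have hmass : ∑ x with ¬ defect φ x ≤ 1 / 10, ‖φ x‖ ≤ sumSq φ / 4 := by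
    have h1 : ∑ x with ¬ defect φ x ≤ 1 / 10, ‖φ x‖
        ≤ ∑ x with ¬ defect φ x ≤ 1 / 10, 200 * (‖φ x‖ - ‖φ x‖ ^ 2) := by
      refine Finset.sum_le_sum fun x hx => ?_
      have hx' : 1 / 10 < defect φ x := by simpa using hx
      have h2 : ‖φ x‖ ^ 2 < 99 / 100 := by nlinarith [hdef x]
      have h3 : ‖φ x‖ ≤ 199 / 200 := by nlinarith [hn0 x]
      nlinarith [hn0 x]
    have h2 : ∑ x with ¬ defect φ x ≤ 1 / 10, 200 * (‖φ x‖ - ‖φ x‖ ^ 2)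
        ≤ ∑ x, 200 * (‖φ x‖ - ‖φ x‖ ^ 2) :=
      Finset.sum_le_sum_of_subset_of_nonneg (Finset.filter_subset _ _) fun x _ _ => by
        nlinarith [hn0 x, hn1 x]
    simp only [← Finset.mul_sum, Finset.sum_sub_distrib] at h1 h2
    rw [sumSq] at hlt hNpos ⊢
    linarith
  have hS : 3 / 4 * sumSq φ ≤ #{x | defect φ x ≤ 1 / 10} := by
    have h1 := hφ.sumSq_le_sum_norm
    rw [← Finset.sum_filter_add_sum_filter_not _ (fun x => defect φ x ≤ 1 / 10)] at h1
    have h2 : ∑ x with defect φ x ≤ 1 / 10, ‖φ x‖ ≤ ∑ x with defect φ x ≤ 1 / 10, (1 : ℝ) :=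
      Finset.sum_le_sum fun x _ => hn1 x
    simp only [Finset.sum_const, nsmul_eq_mul, mul_one] at h2
    linarith
  -- few elements have a defect in `(1/10, 1/2]`
  have hL : (#{x | ¬ defect φ x ≤ 1 / 10 ∧ defect φ x ≤ 1 / 2} : ℝ) ≤ sumSq φ / 2 := by
    have h1 : ∑ x with ¬ defect φ x ≤ 1 / 10 ∧ defect φ x ≤ 1 / 2, (1 / 2 : ℝ)
        ≤ ∑ x with ¬ defect φ x ≤ 1 / 10 ∧ defect φ x ≤ 1 / 2, ‖φ x‖ := by
      refine Finset.sum_le_sum fun x hx => ?_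
      have hx' : defect φ x ≤ 1 / 2 := (Finset.mem_filter.1 hx).2.2
      nlinarith [hdef x, hn0 x, hd0 x]
    have h2 : ∑ x with ¬ defect φ x ≤ 1 / 10 ∧ defect φ x ≤ 1 / 2, ‖φ x‖
        ≤ ∑ x with ¬ defect φ x ≤ 1 / 10, ‖φ x‖ :=
      Finset.sum_le_sum_of_subset_of_nonneg
        (fun x hx => by
          simp only [Finset.mem_filter] at hx ⊢
          exact ⟨hx.1, hx.2.1⟩)
        fun x _ _ => hn0 x
    simp only [Finset.sum_const, nsmul_eq_mul] at h1
    linarith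
  -- No value of the defect lies in `(2/10, 4/10]`: a translate of `{defect ≤ 1/10}` by an element
  -- of defect at most `4/10` stays in `{defect ≤ 1/2}`, hence meets `{defect ≤ 1/10}`.
  have hjump : ∀ x, defect φ x ≤ 4 / 10 → defect φ x ≤ 2 / 10 := by
    intro x hx
    have hmeet : ∃ s, defect φ s ≤ 1 / 10 ∧ defect φ (x * s) ≤ 1 / 10 := by
      by_contra! hc
      have hsub : Finset.image (x * ·) {s | defect φ s ≤ 1 / 10}
          ⊆ ({x | ¬ defect φ x ≤ 1 / 10 ∧ defect φ x ≤ 1 / 2} : Finset K) := by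
        intro y hy
        simp only [Finset.mem_image, Finset.mem_filter, Finset.mem_univ, true_and] at hy ⊢
        obtain ⟨s, hs, rfl⟩ := hy
        exact ⟨not_le.2 (hc s hs), by linarith [hφ.defect_mul_le x s]⟩
      have h1 := Finset.card_le_card hsub
      rw [Finset.card_image_of_injective _ (mul_right_injective x)] at h1
      have h2 : (#{x | defect φ x ≤ 1 / 10} : ℝ)
          ≤ #{x | ¬ defect φ x ≤ 1 / 10 ∧ defect φ x ≤ 1 / 2} := by exact_mod_cast h1
      linarith
    obtain ⟨s, hs, hxs⟩ := hmeet
    have := hφ.defect_mul_le (x * s) s⁻¹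
    rw [hφ.defect_inv, mul_inv_cancel_right] at this
    linarith
  let H : Subgroup K :=
    { carrier := {x | defect φ x ≤ 2 / 10}
      one_mem' := by norm_num [defect, hφ.map_one]
      mul_mem' := fun {x y} hx hy => hjump _ ((hφ.defect_mul_le x y).trans (by
        simp only [Set.mem_ofPred_eq] at hx hy
        linarith))
      inv_mem' := fun {x} hx => by simpa [hφ.defect_inv] using hx }
  have hmem : ∀ x, x ∈ H ↔ defect φ x ≤ 2 / 10 := fun x => Iff.rfl
  have : H.Normal := ⟨fun x hx g => by rwa [hmem, hφ.defect_conj]⟩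
  have hone := hφ.norm_eq_one_of_normal H fun x hx => by
    have := (hmem x).1 hx
    nlinarith [hdef x, hd0 x]
  refine hφ.sum_norm_eq_sumSq_of_normal H hone (hS.trans ?_) (le_trans ?_ hmass)
  · rw [Fintype.card_subtype]
    refine Nat.cast_le.2 (Finset.card_le_card fun x hx => ?_)
    simp only [Finset.mem_filter, Finset.mem_univ, true_and, hmem] at hx ⊢
    linarith
  · refine Finset.sum_le_sum_of_subset_of_nonneg (fun x hx => ?_) fun x _ _ => hn0 x
    simp only [Finset.mem_filter, Finset.mem_univ, true_and, hmem] at hx ⊢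
    linarith

end IsSpherical
end

/-! ### Spherical functions and irreducible representations -/

noncomputable section

open ComplexConjugate MonoidAlgebra

section Characters

variable {K : Type*} [Group K] [Fintype K]

theorem IsIrreducibleCharacter.degree_pos {K : Type*} [Group K] {d : ℕ} {χ : K → ℂ}
    (h : IsIrreducibleCharacter d χ) : 0 < d := by
  obtain ⟨π, hπ, -⟩ := h
  rcases Nat.eq_zero_or_pos d with rfl | hd
  · have h1 : IsSimpleModule ℂ[K] π.asModule := inferInstance
    have h2 := h1.nontrivial
    have h3 : Subsingleton π.asModule := inferInstanceAs (Subsingleton (Fin 0 → ℂ))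
    exact absurd h3 (not_subsingleton_iff_nontrivial.2 h2)
  · exact hd

/-- By Schur's lemma a conjugacy class sum acts as a scalar in an irreducible representation. -/
theorem IsIrreducibleCharacter.sum_conj {d : ℕ} {χ : K → ℂ} (h : IsIrreducibleCharacter d χ)
    (x y : K) : d * ∑ g, χ (g * x * g⁻¹ * y) = Fintype.card K * (χ x * χ y) := by
  obtain ⟨π, hπ, rfl⟩ := h
  let A : Module.End ℂ (Fin d → ℂ) := ∑ g, π (g * x * g⁻¹)
  have hA : ∀ k, A * π k = π k * A := by
    intro k
    simp only [A, Finset.sum_mul, Finset.mul_sum, ← map_mul]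
    rw [← Equiv.sum_comp (Equiv.mulLeft k)]
    refine Finset.sum_congr rfl fun g _ => ?_
    congr 1
    simp [mul_assoc]
  let f : Representation.IntertwiningMap π π := ⟨A, hA⟩
  obtain ⟨c, hc⟩ :=
    (Representation.IsIrreducible.algebraMap_intertwiningMap_bijective_of_isAlgClosed
      (ρ := π)).2 f
  have hAc : A = c • 1 := by
    have : f.toLinearMap = c • 1 := by
      rw [← hc]
      rfl
    exact this
  have htr : ∀ y, ∑ g, π.character (g * x * g⁻¹ * y) = c * π.character y := by
    intro y
    have : LinearMap.trace ℂ _ (A * π y) = c * π.character y := by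
      rw [hAc, smul_mul_assoc, one_mul, map_smul]
      rfl
    rw [← this]
    simp only [A, Finset.sum_mul, map_sum, ← map_mul]
    rfl
  have h1 := htr 1
  simp only [mul_one, π.char_conj, π.char_one] at h1
  simp only [Finset.sum_const, Finset.card_univ, nsmul_eq_mul, Module.finrank_fin_fun] at h1
  rw [htr, ← mul_assoc, ← mul_assoc, h1]
  ring

theorem IsIrreducibleCharacter.isSpherical {d : ℕ} {χ : K → ℂ} (h : IsIrreducibleCharacter d χ) :
    IsSpherical fun x => χ x / d where
  map_one := by
    have hd : (d : ℂ) ≠ 0 := by exact_mod_cast h.degree_pos.ne'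
    obtain ⟨π, hπ, rfl⟩ := h
    rw [π.char_one]
    simp [hd]
  sum_conj x y := by
    have hd : (d : ℂ) ≠ 0 := by exact_mod_cast h.degree_pos.ne'
    have := h.sum_conj x y
    rw [← Finset.sum_div]
    field_simp
    linear_combination this

theorem IsIrreducibleCharacter.sumSq_eq {d : ℕ} {χ : K → ℂ} (h : IsIrreducibleCharacter d χ) :
    (d : ℝ) ^ 2 * sumSq (fun x => χ x / d) = Fintype.card K := by
  have hd : (d : ℂ) ≠ 0 := by exact_mod_cast h.degree_pos.ne'
  have hs := h.isSpherical
  obtain ⟨π, hπ, rfl⟩ := h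
  have hK : (Nat.card K : ℂ) ≠ 0 := by simp
  let _ := invertibleOfNonzero hK
  have h1 := Representation.char_orthonormal π π
  rw [if_pos ⟨Representation.Equiv.refl π⟩, inv_mul_eq_one₀ hK] at h1
  apply Complex.ofReal_injective
  push_cast
  rw [ofReal_sumSq, ← Nat.card_eq_fintype_card, h1, Finset.mul_sum]
  refine Finset.sum_congr rfl fun x _ => ?_
  rw [← hs.apply_inv]
  field_simp

/-- The condition `d_χ ‖χ‖₁ = |K|` says that the central idempotent of `χ` has norm one. -/
theorem IsIrreducibleCharacter.mul_sum_norm_eq_iff {d : ℕ} {χ : K → ℂ}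
    (h : IsIrreducibleCharacter d χ) : (d : ℝ) * ∑ x, ‖χ x‖ = Fintype.card K ↔
      ∑ x, ‖χ x / d‖ = sumSq fun x => χ x / d := by
  have hd : (d : ℝ) ≠ 0 := by exact_mod_cast h.degree_pos.ne'
  rw [← h.sumSq_eq, sq, mul_assoc, mul_right_inj' hd]
  have : ∑ x, ‖χ x / d‖ = (∑ x, ‖χ x‖) / d := by
    rw [Finset.sum_div]
    simp
  rw [this, div_eq_iff hd, mul_comm (sumSq _)]

/-- The minimal central idempotent of `ℂ[K]` attached to a normalised irreducible character. -/
def centralIdempotent (φ : K → ℂ) : ℂ[K] := ∑ x, single x (conj (φ x) / sumSq φ)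

theorem IsSpherical.single_mul_centralIdempotent {φ : K → ℂ} (hφ : IsSpherical φ) (g : K) (c : ℂ) :
    single g c * centralIdempotent φ = centralIdempotent φ * single g c := by
  simp only [centralIdempotent, Finset.mul_sum, Finset.sum_mul, single_mul_single]
  rw [← Equiv.sum_comp (MulAut.conj g⁻¹).toEquiv]
  refine Finset.sum_congr rfl fun x _ => ?_
  have := hφ.apply_conj g⁻¹ x
  rw [inv_inv] at this
  simp [mul_assoc, mul_comm c, ← this]

theorem IsSpherical.mul_centralIdempotent {φ : K → ℂ} (hφ : IsSpherical φ) (r : ℂ[K]) :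
    r * centralIdempotent φ = centralIdempotent φ * r := by
  induction r using MonoidAlgebra.induction_linear with
  | zero => simp
  | add x y hx hy => rw [add_mul, mul_add, hx, hy]
  | single g c => exact hφ.single_mul_centralIdempotent g c

theorem IsSpherical.isIdempotentElem_centralIdempotent {φ : K → ℂ} (hφ : IsSpherical φ) :
    IsIdempotentElem (centralIdempotent φ) := by
  have hN : (sumSq φ : ℂ) ≠ 0 := by exact_mod_cast hφ.sumSq_pos.ne'
  rw [IsIdempotentElem]
  simp only [centralIdempotent, Finset.mul_sum, Finset.sum_mul, single_mul_single]
  rw [Finset.sum_comm]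
  calc _ = ∑ y, ∑ x, single x (conj (φ y) / sumSq φ * (conj (φ (y⁻¹ * x)) / sumSq φ)) := by
        refine Finset.sum_congr rfl fun y _ => ?_
        rw [← Equiv.sum_comp (Equiv.mulLeft y) (fun x =>
          single x (conj (φ y) / sumSq φ * (conj (φ (y⁻¹ * x)) / sumSq φ)))]
        simp
    _ = _ := by
        rw [Finset.sum_comm]
        refine Finset.sum_congr rfl fun x _ => ?_
        have h1 := congrArg conj (hφ.sum_mul_apply_inv_mul x)
        simp only [map_sum, map_mul, Complex.conj_ofReal] at h1
        refine ((map_sum (singleAddHom x) _ _).symm).trans (congrArg (single x) ?_)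
        simp only [div_mul_div_comm, ← Finset.sum_div, h1]
        field_simp

theorem IsSpherical.centralIdempotent_ne_zero {φ : K → ℂ} (hφ : IsSpherical φ) :
    centralIdempotent φ ≠ 0 := by
  classical
  have hN : (sumSq φ : ℂ) ≠ 0 := by exact_mod_cast hφ.sumSq_pos.ne'
  intro h
  have h1 := congrArg (fun r : ℂ[K] => r.coeff 1) h
  simp only [centralIdempotent, coeff_sum, Finsupp.finsetSum_apply, coeff_single,
    Finsupp.single_apply, Finset.sum_ite_eq', Finset.mem_univ, if_true, hφ.map_one, coeff_zero,
    Finsupp.coe_zero, Pi.zero_apply] at h1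
  simp [hN] at h1

/-- An irreducible representation on an arbitrary space may be transported to `ℂ^d`. -/
theorem isIrreducibleCharacter_character {K V : Type*} [Group K] [AddCommGroup V] [Module ℂ V]
    [FiniteDimensional ℂ V] (ρ : Representation ℂ K V) (hρ : ρ.IsIrreducible) :
    IsIrreducibleCharacter (Module.finrank ℂ V) ρ.character := by
  let b : V ≃ₗ[ℂ] (Fin (Module.finrank ℂ V) → ℂ) := (Module.finBasis ℂ V).equivFun
  let π : Representation ℂ K (Fin (Module.finrank ℂ V) → ℂ) :=
    (b.conjRingEquiv : Module.End ℂ V →* _).comp ρ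
  have hπb : ∀ g, (b : V →ₗ[ℂ] _) ∘ₗ ρ g = π g ∘ₗ b := by
    intro g
    ext v
    simp [π]
  let f : Representation.IntertwiningMap ρ π := ⟨b, hπb⟩
  have hf : Function.Bijective (Representation.IntertwiningMap.equivLinearMapAsModule ρ π f) :=
    b.bijective
  refine ⟨π, ?_, ?_⟩
  · rw [Representation.irreducible_iff_isSimpleModule_asModule] at hρ ⊢
    exact IsSimpleModule.congr (LinearEquiv.ofBijective _ hf).symm
  · funext g
    exact (LinearMap.trace_conj' (ρ g) b).symm

/-- A simple module on which the central idempotent of `φ` acts as the identity affords `φ`, because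
the trace of the idempotent is a pairing of `φ` with the character of the module. -/
theorem IsSpherical.exists_isIrreducibleCharacter_of_isSimpleModule {φ : K → ℂ}
    (hφ : IsSpherical φ) (M : Type*) [AddCommGroup M] [Module ℂ M] [Module ℂ[K] M]
    [IsScalarTower ℂ ℂ[K] M] [Module.Finite ℂ[K] M] [IsSimpleModule ℂ[K] M]
    (hM : ∀ v : M, centralIdempotent φ • v = v) :
    ∃ (d : ℕ) (χ : K → ℂ), IsIrreducibleCharacter d χ ∧ φ = fun x => χ x / d := by
  have hN : (sumSq φ : ℂ) ≠ 0 := by exact_mod_cast hφ.sumSq_pos.ne'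
  let ρ : Representation ℂ K M := Representation.ofModule' M
  have hρa : ∀ r v, ρ.asAlgebraHom r v = r • v := by
    intro r v
    have : ρ.asAlgebraHom = Algebra.lsmul ℂ ℂ M := Equiv.apply_symm_apply _ _
    rw [this]
    rfl
  let E : ρ.asModule ≃ₗ[ℂ[K]] M :=
    { ρ.asModuleEquiv with
      map_smul' := fun r v => (ρ.asModuleEquiv_map_smul r v).trans (hρa r _) }
  have hρ : ρ.IsIrreducible := by
    rw [Representation.irreducible_iff_isSimpleModule_asModule]
    exact IsSimpleModule.congr E
  have hfin : FiniteDimensional ℂ M := Module.Finite.trans ℂ[K] _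
  have hacts : ρ.asAlgebraHom (centralIdempotent φ) = 1 := by
    ext v
    rw [hρa, hM]
    simp
  have hirr := isIrreducibleCharacter_character ρ hρ
  have hd := hirr.degree_pos
  refine ⟨_, _, hirr, hφ.eq_of_sum_ne_zero hirr.isSpherical ?_⟩
  -- the idempotent acts as the identity, so its trace is not zero
  have htr := congrArg (LinearMap.trace ℂ _) hacts
  simp only [centralIdempotent, map_sum, Representation.asAlgebraHom_single, map_smul,
    LinearMap.trace_one] at htr
  intro hc
  have hd' : (Module.finrank ℂ M : ℂ) ≠ 0 := by
    exact_mod_cast hd.ne'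
  refine hd' (htr.symm.trans ?_)
  have hc' := congrArg conj hc
  rw [map_sum, map_zero] at hc'
  calc _ = ∑ x, conj (φ x * (ρ.character x⁻¹ / Module.finrank ℂ _)) *
        (Module.finrank ℂ M / sumSq φ) := by
        refine Finset.sum_congr rfl fun x _ => ?_
        have h1 := hirr.isSpherical.apply_inv x
        rw [map_mul, h1, Complex.conj_conj, smul_eq_mul]
        change _ * ρ.character x = _
        field_simp
    _ = 0 := by rw [← Finset.sum_mul, hc', zero_mul]

/-- Every function satisfying the functional equation is the normalised character of an irreducible
representation, namely of a simple quotient of `ℂ[K]` on which the corresponding central idempotent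
acts as the identity. -/
theorem IsSpherical.exists_isIrreducibleCharacter {φ : K → ℂ} (hφ : IsSpherical φ) :
    ∃ (d : ℕ) (χ : K → ℂ), IsIrreducibleCharacter d χ ∧ φ = fun x => χ x / d := by
  set e := centralIdempotent φ with he
  have hproper : Ideal.span {1 - e} ≠ (⊤ : Ideal ℂ[K]) := by
    intro hc
    have h1 : (1 : ℂ[K]) ∈ Ideal.span {1 - e} := by rw [hc]; trivial
    obtain ⟨a, ha⟩ := Ideal.mem_span_singleton'.1 h1
    apply hφ.centralIdempotent_ne_zero
    rw [← he, ← one_mul e, ← ha, mul_assoc, sub_mul, one_mul,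
      hφ.isIdempotentElem_centralIdempotent.eq, sub_self, mul_zero]
  obtain ⟨L, hL, hle⟩ := Ideal.exists_le_maximal _ hproper
  have heL : ∀ v : ℂ[K] ⧸ L, e • v = v := by
    intro v
    obtain ⟨r, rfl⟩ := Submodule.Quotient.mk_surjective L v
    rw [← Submodule.Quotient.mk_smul, Submodule.Quotient.eq, smul_eq_mul]
    have : e * r - r = -(r * (1 - e)) := by
      rw [mul_sub, hφ.mul_centralIdempotent, mul_one, neg_sub]
    rw [this]
    exact neg_mem (L.smul_mem r (hle (Ideal.mem_span_singleton_self _)))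
  have hsimple : IsSimpleModule ℂ[K] (ℂ[K] ⧸ L) := isSimpleModule_iff_isCoatom.2 hL.out
  exact hφ.exists_isIrreducibleCharacter_of_isSimpleModule _ heL

end Characters
end

/-! ### Direct products of finite groups -/

noncomputable section

open ComplexConjugate

section Products

/-- Restricting a normalised irreducible character to a normal subgroup on which conjugation by any
element agrees with an inner automorphism. -/
theorem IsSpherical.comp {H K : Type*} [Group H] [Fintype H] [Group K] [Fintype K] {φ : K → ℂ}
    (hφ : IsSpherical φ) (j : H →* K)
    (hj : ∀ g : K, ∃ h : H, ∀ x, g * j x * g⁻¹ = j (h * x * h⁻¹)) :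
    IsSpherical fun x => φ (j x) where
  map_one := by simp [hφ.map_one]
  sum_conj x y := by
    have hK : (Fintype.card K : ℂ) ≠ 0 := by simp
    have h1 : ∀ g : K, ∑ h, φ (g * j (h * x * h⁻¹) * g⁻¹ * j y) = ∑ h, φ (j (h * x * h⁻¹ * y)) := by
      intro g
      obtain ⟨k, hk⟩ := hj g
      rw [← Equiv.sum_comp (Equiv.mulLeft k) (fun h => φ (j (h * x * h⁻¹ * y)))]
      refine Finset.sum_congr rfl fun h _ => ?_
      rw [hk, ← map_mul]
      simp [mul_assoc]
    have h2 : ∑ g : K, ∑ h : H, φ (g * j (h * x * h⁻¹) * g⁻¹ * j y)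
        = Fintype.card K * ∑ h, φ (j (h * x * h⁻¹ * y)) := by
      rw [Finset.sum_congr rfl fun g _ => h1 g]
      simp
    rw [Finset.sum_comm, Finset.sum_congr rfl fun h _ => hφ.sum_conj (j (h * x * h⁻¹)) (j y)] at h2
    simp only [map_mul, map_inv, hφ.apply_conj, Finset.sum_const, Finset.card_univ,
      nsmul_eq_mul] at h2
    apply mul_left_cancel₀ hK
    simp only [map_mul, map_inv]
    rw [← h2]
    ring

theorem IsSpherical.apply_mul_of_forall {K : Type*} [Group K] [Fintype K] {φ : K → ℂ}
    (hφ : IsSpherical φ) {x y : K} (h : ∀ g, φ (g * x * g⁻¹ * y) = φ (x * y)) :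
    φ (x * y) = φ x * φ y := by
  have hK : (Fintype.card K : ℂ) ≠ 0 := by simp
  have := hφ.sum_conj x y
  simp only [h, Finset.sum_const, Finset.card_univ, nsmul_eq_mul] at this
  exact mul_left_cancel₀ hK this

variable {κ : Type*} [Fintype κ] [DecidableEq κ] {H : κ → Type*} [∀ i, Group (H i)]
  [∀ i, Fintype (H i)]

theorem IsSpherical.pi {φ : ∀ i, H i → ℂ} (hφ : ∀ i, IsSpherical (φ i)) :
    IsSpherical fun x : ∀ i, H i => ∏ i, φ i (x i) where
  map_one := by simp [(hφ _).map_one]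
  sum_conj x y := by
    have := Fintype.prod_sum fun i (g : H i) => φ i (g * x i * g⁻¹ * y i)
    simp only [(hφ _).sum_conj] at this
    simp only [Pi.mul_apply, Pi.inv_apply]
    rw [← this]
    simp [Finset.prod_mul_distrib, Fintype.card_pi]

theorem conj_mulSingle {κ : Type*} [DecidableEq κ] {H : κ → Type*} [∀ i, Group (H i)]
    (i : κ) (g : ∀ i, H i) (x : H i) :
    g * Pi.mulSingle i x * g⁻¹ = Pi.mulSingle i (g i * x * (g i)⁻¹) := by
  ext k
  rcases eq_or_ne k i with rfl | hk
  · simp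
  · simp [hk]

theorem IsSpherical.comp_mulSingle {φ : (∀ i, H i) → ℂ} (hφ : IsSpherical φ) (i : κ) :
    IsSpherical fun x : H i => φ (Pi.mulSingle i x) :=
  hφ.comp (MonoidHom.mulSingle H i) fun g => ⟨g i, fun x => conj_mulSingle i g x⟩

/-- A normalised irreducible character of a finite direct product is the product of its
restrictions to the factors. -/
theorem IsSpherical.eq_prod {φ : (∀ i, H i) → ℂ} (hφ : IsSpherical φ) (x : ∀ i, H i) :
    φ x = ∏ i, φ (Pi.mulSingle i (x i)) := by
  have key : ∀ s : Finset κ, φ (s.piecewise x 1) = ∏ i ∈ s, φ (Pi.mulSingle i (x i)) := by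
    intro s
    induction s using Finset.induction_on with
    | empty =>
      simp only [Finset.piecewise_empty, Finset.prod_empty]
      exact hφ.map_one
    | insert i s his ih =>
      have h1 : (insert i s).piecewise x 1 = s.piecewise x 1 * Pi.mulSingle i (x i) := by
        ext k
        rcases eq_or_ne k i with rfl | hk
        · simp [his]
        · simp [hk, Finset.piecewise]
      rw [h1, Finset.prod_insert his, ← ih, mul_comm (φ (Pi.mulSingle i _))]
      refine hφ.apply_mul_of_forall fun g => ?_
      have h2 : g * s.piecewise x 1 * g⁻¹ * Pi.mulSingle i (x i)
          = Function.update g i 1 * (s.piecewise x 1 * Pi.mulSingle i (x i))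
            * (Function.update g i 1)⁻¹ := by
        ext k
        rcases eq_or_ne k i with rfl | hk
        · simp [his]
        · simp [hk]
      rw [h2, hφ.apply_conj]
  have := key Finset.univ
  rwa [Finset.piecewise_univ] at this

theorem sum_norm_pi {κ : Type*} [Fintype κ] [DecidableEq κ] {H : κ → Type*} [∀ i, Fintype (H i)]
    (φ : ∀ i, H i → ℂ) :
    ∑ x : ∀ i, H i, ‖∏ i, φ i (x i)‖ = ∏ i, ∑ x, ‖φ i x‖ := by
  rw [Fintype.prod_sum]
  simp

theorem sumSq_pi {κ : Type*} [Fintype κ] [DecidableEq κ] {H : κ → Type*} [∀ i, Fintype (H i)]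
    (φ : ∀ i, H i → ℂ) :
    sumSq (fun x : ∀ i, H i => ∏ i, φ i (x i)) = ∏ i, sumSq (φ i) := by
  simp only [sumSq]
  rw [Fintype.prod_sum]
  simp [Finset.prod_pow]

end Products
end

/-! ### Point masses, pairings and the centre of the convolution algebra -/

noncomputable section

open ComplexConjugate

namespace EllOne

variable {G : Type u}

open Classical in
/-- The point mass at `a`. -/
def delta (a : G) : EllOne G :=
  ofSummable (Pi.single a 1) (by
    refine summable_of_ne_finset_zero (s := {a}) fun x hx => ?_
    have : x ≠ a := by simpa using hx
    simp [this])

open Classical in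
theorem delta_apply (a x : G) : delta a x = if x = a then 1 else 0 := by
  change (Pi.single a 1 : G → ℂ) x = _
  simp [Pi.single_apply]

@[simp] theorem norm_delta (a : G) : ‖delta a‖ = 1 := by
  rw [norm_eq_tsum, tsum_eq_single a]
  · simp [delta_apply]
  · intro x hx
    simp [delta_apply, hx]

theorem hasSum_smul_delta (f : EllOne G) : HasSum (fun x => f x • delta x) f := by
  classical
  have h := lp.hasSum_single (E := fun _ : G => ℂ) (p := 1) (by simp) f
  have e : ∀ x, f x • delta x = (lp.single 1 x (f x) : lp (fun _ : G => ℂ) 1) := by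
    intro x
    ext y
    rw [smul_apply, delta_apply]
    change _ = (lp.single (E := fun _ : G => ℂ) 1 x (f x)) y
    rw [lp.single_apply, Pi.single_apply]
    simp
  simp only [e]
  exact h

/-- Pairing of `ℓ¹(G)` with a bounded function `B` on `G`. -/
def pairing (B : G → ℂ) (f : EllOne G) : ℂ := ∑' x, f x * B x

section Pairing

variable {B : G → ℂ} {C : ℝ}

theorem summable_pairing (hB : ∀ x, ‖B x‖ ≤ C) (f : EllOne G) : Summable fun x => f x * B x := by
  refine Summable.of_norm_bounded (f.summable_norm.mul_right C) fun x => ?_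
  rw [norm_mul]
  exact mul_le_mul_of_nonneg_left (hB x) (norm_nonneg _)

theorem norm_pairing_le (hB : ∀ x, ‖B x‖ ≤ 1) (f : EllOne G) : ‖pairing B f‖ ≤ ‖f‖ := by
  rw [norm_eq_tsum]
  refine tsum_of_norm_bounded f.summable_norm.hasSum fun x => ?_
  rw [norm_mul]
  exact mul_le_of_le_one_right (norm_nonneg _) (hB x)

theorem pairing_add (hB : ∀ x, ‖B x‖ ≤ C) (f g : EllOne G) :
    pairing B (f + g) = pairing B f + pairing B g := by
  simp only [pairing, add_apply, add_mul]
  exact (summable_pairing hB f).tsum_add (summable_pairing hB g)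

theorem pairing_smul (c : ℂ) (f : EllOne G) : pairing B (c • f) = c * pairing B f := by
  simp only [pairing, smul_apply, mul_assoc, tsum_mul_left]

theorem pairing_zero : pairing B (0 : EllOne G) = 0 := by simp [pairing]

theorem pairing_sum (hB : ∀ x, ‖B x‖ ≤ C) {α : Type*} (s : Finset α) (f : α → EllOne G) :
    pairing B (∑ i ∈ s, f i) = ∑ i ∈ s, pairing B (f i) :=
  map_sum (⟨⟨pairing B, pairing_zero⟩, pairing_add hB⟩ : EllOne G →+ ℂ) f s

theorem pairing_delta (a : G) : pairing B (delta a) = B a := by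
  rw [pairing, tsum_eq_single a]
  · simp [delta_apply]
  · intro x hx
    simp [delta_apply, hx]

end Pairing

variable [Group G]

theorem delta_mul_apply (a : G) (f : EllOne G) (x : G) : (delta a * f) x = f (a⁻¹ * x) := by
  rw [mul_apply, tsum_eq_single a]
  · simp [delta_apply]
  · intro y hy
    simp [delta_apply, hy]

theorem mul_delta_apply (a : G) (f : EllOne G) (x : G) : (f * delta a) x = f (x * a⁻¹) := by
  rw [mul_apply, tsum_eq_single (x * a⁻¹)]
  · simp [delta_apply]
  · intro y hy
    have : ¬ y⁻¹ * x = a := fun h => hy (by rw [← h]; group)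
    simp [delta_apply, this]

theorem delta_mul_delta (a b : G) : delta a * delta b = delta (a * b) := by
  ext x
  classical
  rw [delta_mul_apply, delta_apply, delta_apply]
  simp only [inv_mul_eq_iff_eq_mul]

theorem delta_one : delta (1 : G) = 1 := by
  ext x
  rw [delta_apply, one_apply]

/-- The centre of `ℓ¹(G)` consists of the class functions. -/
theorem mem_center_iff {f : EllOne G} :
    f ∈ Subalgebra.center ℂ (EllOne G) ↔ ∀ g x, f (g * x * g⁻¹) = f x := by
  rw [Subalgebra.mem_center_iff]
  constructor
  · intro h g x
    have := congrArg (fun w : EllOne G => w (g * x)) (h (delta g))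
    simp only [delta_mul_apply, mul_delta_apply] at this
    rw [← this]
    simp
  · intro h w
    ext x
    calc (w * f) x = ∑' z, w (x * z⁻¹) * f z := by
          rw [mul_apply, ← Equiv.tsum_eq ((Equiv.inv G).trans (Equiv.mulLeft x))]
          simp
      _ = ∑' z, f (x * z * x⁻¹) * w ((x * z * x⁻¹)⁻¹ * x) := by
          refine tsum_congr fun z => ?_
          rw [h, mul_comm]
          congr 2
          group
      _ = (f * w) x := by
          rw [mul_apply, ← Equiv.tsum_eq (MulAut.conj x).toEquiv (fun y => f y * w (y⁻¹ * x))]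
          rfl

theorem mem_center_of_delta {f : EllOne G} (h : ∀ g, delta g * f = f * delta g) :
    f ∈ Subalgebra.center ℂ (EllOne G) := by
  refine mem_center_iff.2 fun g x => ?_
  have := congrArg (fun w : EllOne G => w (g * x)) (h g)
  simp only [delta_mul_apply, mul_delta_apply] at this
  rw [← this, inv_mul_cancel_left]

theorem pairing_delta_mul (B : G → ℂ) (a : G) (f : EllOne G) :
    pairing B (delta a * f) = pairing (fun x => B (a * x)) f := by
  simp only [pairing, delta_mul_apply]
  rw [← Equiv.tsum_eq (Equiv.mulLeft a)]
  simp

theorem norm_one_eq : ‖(1 : EllOne G)‖ = 1 := by rw [← delta_one, norm_delta]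

theorem isClosed_center : IsClosed (Subalgebra.center ℂ (EllOne G) : Set (EllOne G)) := by
  have : (Subalgebra.center ℂ (EllOne G) : Set (EllOne G))
      = ⋂ b : EllOne G, {f | b * f = f * b} := by
    ext f
    simp only [SetLike.mem_coe, Subalgebra.mem_center_iff, Set.mem_iInter, Set.mem_ofPred_eq]
  rw [this]
  exact isClosed_iInter fun b => isClosed_eq (continuous_const.mul continuous_id)
    (continuous_id.mul continuous_const)

end EllOne

instance ZEllOne.instNormedCommRing (G : Type u) [Group G] : NormedCommRing (ZEllOne G) where
  __ := (inferInstance : NormedRing (ZEllOne G))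
  mul_comm a b := Subtype.ext (Subalgebra.mem_center_iff.1 b.2 a)

instance ZEllOne.instCompleteSpace (G : Type u) [Group G] : CompleteSpace (ZEllOne G) :=
  EllOne.isClosed_center.completeSpace_coe

end

/-! ### Direct factors and their central idempotents -/

noncomputable section

open ComplexConjugate EllOne

/-- A group `K` embedded in `G` as a direct factor: `incl` embeds `K`, `proj` is a retraction
of `G` onto `K`, and `G` acts on `K` by conjugation through `proj`. -/
structure DirectFactor (G : Type u) (K : Type v) [Group G] [Group K] where
  incl : K →* G
  proj : G →* K
  proj_incl : ∀ k, proj (incl k) = k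
  conj_incl : ∀ g k, g * incl k * g⁻¹ = incl (proj g * k * (proj g)⁻¹)

namespace DirectFactor

variable {G : Type u} {K : Type v} [Group G] [Group K] [Fintype K] (D : DirectFactor G K)

/-- The average of the point masses over the conjugacy class of `s ∈ K`, a central element of
`ℓ¹(G)`. -/
def classAvg (s : K) : ZEllOne G :=
  ⟨(Fintype.card K : ℂ)⁻¹ • ∑ g, delta (D.incl (g * s * g⁻¹)), by
    refine mem_center_of_delta fun g => ?_
    rw [mul_smul_comm, smul_mul_assoc, Finset.mul_sum, Finset.sum_mul]
    congr 1
    rw [← Equiv.sum_comp (Equiv.mulLeft (D.proj g))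
      (fun h => delta (D.incl (h * s * h⁻¹)) * delta g)]
    refine Finset.sum_congr rfl fun h _ => ?_
    rw [delta_mul_delta, delta_mul_delta]
    congr 1
    have := D.conj_incl g (h * s * h⁻¹)
    rw [mul_inv_eq_iff_eq_mul] at this
    rw [this]
    simp [mul_assoc]⟩

theorem coe_classAvg (s : K) : (D.classAvg s : EllOne G)
    = (Fintype.card K : ℂ)⁻¹ • ∑ g, delta (D.incl (g * s * g⁻¹)) := rfl

theorem classAvg_one : D.classAvg 1 = 1 := by
  apply Subtype.ext
  have hK : (Fintype.card K : ℂ) ≠ 0 := by simp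
  rw [coe_classAvg]
  simp only [mul_one, mul_inv_cancel, map_one, delta_one, Finset.sum_const, Finset.card_univ]
  rw [← Nat.cast_smul_eq_nsmul ℂ, smul_smul, inv_mul_cancel₀ hK, one_smul]
  rfl

/-- Averaging over conjugacy classes does not change a class function. -/
theorem coe_sum_smul_classAvg {f : K → ℂ} (hf : ∀ g h, f (g * h * g⁻¹) = f h) :
    ((∑ s, f s • D.classAvg s : ZEllOne G) : EllOne G) = ∑ s, f s • delta (D.incl s) := by
  have hK : (Fintype.card K : ℂ) ≠ 0 := by simp
  rw [AddSubmonoidClass.coe_finsetSum]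
  simp only [Subalgebra.coe_smul, coe_classAvg, Finset.smul_sum]
  rw [Finset.sum_comm]
  have h1 : ∀ g : K, ∑ s, f s • (Fintype.card K : ℂ)⁻¹ • delta (D.incl (g * s * g⁻¹))
      = (Fintype.card K : ℂ)⁻¹ • ∑ s, f s • delta (D.incl s) := by
    intro g
    rw [Finset.smul_sum, ← Equiv.sum_comp (MulAut.conj g).toEquiv
      (fun s => (Fintype.card K : ℂ)⁻¹ • f s • delta (D.incl s))]
    refine Finset.sum_congr rfl fun s _ => ?_
    simp [hf, smul_comm (f s)]
  rw [Finset.sum_congr rfl fun g _ => h1 g, Finset.sum_const, Finset.card_univ,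
    ← Nat.cast_smul_eq_nsmul ℂ, smul_smul, mul_inv_cancel₀ hK, one_smul]

theorem classAvg_mul (s t : K) : D.classAvg s * D.classAvg t
    = (Fintype.card K : ℂ)⁻¹ • ∑ g, D.classAvg (g * s * g⁻¹ * t) := by
  apply Subtype.ext
  rw [Subalgebra.coe_mul, Subalgebra.coe_smul, AddSubmonoidClass.coe_finsetSum]
  simp only [coe_classAvg]
  rw [smul_mul_assoc, mul_smul_comm, ← Finset.smul_sum, Finset.sum_mul_sum, Finset.sum_comm]
  congr 2
  rw [Finset.sum_comm (f := fun g h => delta (D.incl (h * (g * s * g⁻¹ * t) * h⁻¹)))]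
  refine Finset.sum_congr rfl fun h _ => ?_
  rw [← Equiv.sum_comp (Equiv.mulLeft h)]
  refine Finset.sum_congr rfl fun g _ => ?_
  rw [delta_mul_delta, ← map_mul]
  congr 2
  simp [mul_assoc]

/-- The central idempotent of `ℓ¹(G)` attached to a normalised irreducible character of the direct
factor `K`. -/
def idem (φ : K → ℂ) : ZEllOne G := ∑ y, (conj (φ y) / sumSq φ) • D.classAvg y

variable {φ : K → ℂ}

/-- A class average acts on the idempotent of `φ` as the scalar `φ s`. -/
theorem classAvg_mul_idem (hφ : IsSpherical φ) (s : K) :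
    D.classAvg s * D.idem φ = φ s • D.idem φ := by
  have hK : (Fintype.card K : ℂ) ≠ 0 := by simp
  simp only [idem, Finset.mul_sum, Finset.smul_sum, mul_smul_comm, classAvg_mul]
  rw [Finset.sum_comm]
  have h1 : ∀ g : K, ∑ y, (conj (φ y) / sumSq φ) • (Fintype.card K : ℂ)⁻¹ •
      D.classAvg (g * s * g⁻¹ * y) = ∑ y, (conj (φ (g * s⁻¹ * g⁻¹ * y)) / sumSq φ) •
      (Fintype.card K : ℂ)⁻¹ • D.classAvg y := by
    intro g
    rw [← Equiv.sum_comp (Equiv.mulLeft (g * s * g⁻¹)) (fun y =>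
      (conj (φ (g * s⁻¹ * g⁻¹ * y)) / sumSq φ) • (Fintype.card K : ℂ)⁻¹ • D.classAvg y)]
    refine Finset.sum_congr rfl fun y _ => ?_
    simp [mul_assoc]
  rw [Finset.sum_congr rfl fun g _ => h1 g, Finset.sum_comm]
  refine Finset.sum_congr rfl fun y _ => ?_
  rw [← Finset.sum_smul, ← Finset.sum_div, ← map_sum, hφ.sum_conj, smul_smul, smul_smul,
    map_mul, map_mul, hφ.apply_inv]
  congr 1
  simp
  field_simp

theorem sum_smul_classAvg_mul_idem (hφ : IsSpherical φ) (f : K → ℂ) :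
    (∑ s, f s • D.classAvg s) * D.idem φ = (∑ s, f s * φ s) • D.idem φ := by
  rw [Finset.sum_mul, Finset.sum_smul]
  refine Finset.sum_congr rfl fun s _ => ?_
  rw [smul_mul_assoc, D.classAvg_mul_idem hφ, smul_smul]

theorem coe_idem (hφ : IsSpherical φ) :
    (D.idem φ : EllOne G) = ∑ y, (conj (φ y) / sumSq φ) • delta (D.incl y) :=
  D.coe_sum_smul_classAvg (f := fun y => conj (φ y) / sumSq φ) (by simp [hφ.apply_conj])

theorem norm_idem_le (hφ : IsSpherical φ) : ‖D.idem φ‖ ≤ (∑ x, ‖φ x‖) / sumSq φ := by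
  change ‖(D.idem φ : EllOne G)‖ ≤ _
  rw [D.coe_idem hφ, Finset.sum_div]
  refine norm_sum_le_of_le _ fun y _ => ?_
  rw [norm_smul, norm_delta, mul_one, norm_div, RCLike.norm_conj, Complex.norm_real,
    Real.norm_of_nonneg hφ.sumSq_pos.le]

/-- A character of the centre of `ℓ¹(G)` restricts to a normalised irreducible character of `K`. -/
theorem isSpherical_comp_classAvg (ω : ZEllOne G →ₐ[ℂ] ℂ) :
    IsSpherical fun s => ω (D.classAvg s) where
  map_one := by rw [classAvg_one, map_one]
  sum_conj x y := by
    have hK : (Fintype.card K : ℂ) ≠ 0 := by simp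
    rw [← map_mul, classAvg_mul, map_smul, map_sum, smul_eq_mul, mul_inv_cancel_left₀ hK]

theorem apply_idem (ω : ZEllOne G →ₐ[ℂ] ℂ) :
    ω (D.idem fun s => ω (D.classAvg s)) = 1 := by
  have h := D.isSpherical_comp_classAvg ω
  have hN := h.sumSq_pos.ne'
  simp only [idem, map_sum, map_smul, smul_eq_mul, div_mul_eq_mul_div, ← Finset.sum_div]
  rw [div_eq_one_iff_eq (by exact_mod_cast hN), ofReal_sumSq]
  simp only [mul_comm]

/-- The restriction to the direct factor `K` of a central element of `ℓ¹(G)`. -/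
def trunc (a : ZEllOne G) : ZEllOne G := ∑ s, (a : EllOne G) (D.incl s) • D.classAvg s

theorem apply_incl_conj {G : Type u} {K : Type v} [Group G] [Group K]
    (D : DirectFactor G K) (a : ZEllOne G) (g h : K) :
    (a : EllOne G) (D.incl (g * h * g⁻¹)) = (a : EllOne G) (D.incl h) := by
  simpa using mem_center_iff.1 a.2 (D.incl g) (D.incl h)

theorem coe_trunc (a : ZEllOne G) :
    (D.trunc a : EllOne G) = ∑ s, (a : EllOne G) (D.incl s) • delta (D.incl s) :=
  D.coe_sum_smul_classAvg (D.apply_incl_conj a)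

theorem trunc_mul_idem (ω : ZEllOne G →ₐ[ℂ] ℂ) (a : ZEllOne G) :
    D.trunc a * D.idem (fun s => ω (D.classAvg s))
      = ω (D.trunc a) • D.idem (fun s => ω (D.classAvg s)) := by
  rw [trunc, D.sum_smul_classAvg_mul_idem (D.isSpherical_comp_classAvg ω)]
  simp

end DirectFactor
end

/-! ### Lower bounds for central idempotents -/

noncomputable section

open ComplexConjugate EllOne

theorem IsSpherical.sum_conj_mul_apply_mul {K : Type*} [Group K] [Fintype K] {φ : K → ℂ}
    (hφ : IsSpherical φ) {b : K → ℂ} (hb : ∀ g h, b (g * h * g⁻¹) = b h) (t : K) :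
    ∑ s, conj (φ s) * b (s * t) = (∑ s, conj (φ s) * b s) * φ t := by
  have h1 := hφ.sum_mul_apply_mul (w := fun h => b h⁻¹)
    (fun g h => by rw [← hb g h⁻¹]; congr 1; group) t
  have h2 : ∑ h, b h⁻¹ * φ h = ∑ s, conj (φ s) * b s := by
    rw [← Equiv.sum_comp (Equiv.inv K)]
    simp [hφ.apply_inv, mul_comm]
  rw [← h2, ← h1, ← Equiv.sum_comp ((Equiv.mulRight t).trans (Equiv.inv K))
    (fun h => b h⁻¹ * φ (h * t))]
  refine Finset.sum_congr rfl fun s _ => ?_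
  have h3 : φ (t⁻¹ * s⁻¹ * t) = φ s⁻¹ := by simpa using hφ.apply_conj t⁻¹ s⁻¹
  simp [h3, hφ.apply_inv, mul_comm]

namespace DirectFactor

variable {G : Type u} {K : Type v} [Group G] [Group K] [Fintype K] (D : DirectFactor G K)
  {Φ : G → ℂ}

theorem pairing_sum_smul_delta_mul {B : G → ℂ} {C : ℝ} (hB : ∀ x, ‖B x‖ ≤ C) (w : K → ℂ)
    (f : EllOne G) : pairing B ((∑ s, w s • delta (D.incl s)) * f)
      = pairing (fun x => ∑ s, w s * B (D.incl s * x)) f := by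
  rw [Finset.sum_mul, pairing_sum hB]
  simp only [smul_mul_assoc, pairing_smul, pairing_delta_mul]
  simp only [pairing, Finset.mul_sum]
  rw [Summable.tsum_finsetSum fun s _ => ?_]
  · refine Finset.sum_congr rfl fun s _ => ?_
    rw [← tsum_mul_left]
    exact tsum_congr fun x => by ring
  · have := (summable_pairing (B := fun x => B (D.incl s * x)) (fun x => hB _) f).mul_left (w s)
    exact this.congr fun x => by ring

/-- The function `x ↦ b (x_K) * Φ (x_K⁻¹ x)`, where `x_K` is the component of `x` in `K`. -/
def extend (b : K → ℂ) (Φ : G → ℂ) (x : G) : ℂ :=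
  b (D.proj x) * Φ ((D.incl (D.proj x))⁻¹ * x)

theorem extend_incl_mul {G : Type u} {K : Type v} [Group G] [Group K]
    (D : DirectFactor G K) (b : K → ℂ) (Φ : G → ℂ) (s : K) (x : G) :
    D.extend b Φ (D.incl s * x)
      = b (s * D.proj x) * Φ ((D.incl (D.proj x))⁻¹ * x) := by
  simp [extend, D.proj_incl, mul_assoc]

/-- Convolution on `K` is moved onto the `K`-component of the function paired with. -/
theorem pairing_sum_smul_delta_mul_extend {b : K → ℂ} {C : ℝ}
    (hB : ∀ x, ‖D.extend b Φ x‖ ≤ C) {w : K → ℂ} {c : ℂ} {b' : K → ℂ}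
    (h : ∀ t, ∑ s, w s * b (s * t) = c * b' t) (f : EllOne G) :
    pairing (D.extend b Φ) ((∑ s, w s • delta (D.incl s)) * f)
      = c * pairing (D.extend b' Φ) f := by
  rw [D.pairing_sum_smul_delta_mul hB, pairing, pairing, ← tsum_mul_left]
  refine tsum_congr fun x => ?_
  simp only [extend_incl_mul, ← mul_assoc, ← Finset.sum_mul, h]
  rw [extend]
  ring

/-- Pairing with a function `Φ` that is a product over `K` and its complement, and spherical on `K`,
is multiplicative on central elements supported in `K`. -/
theorem pairing_trunc_mul (hΦ1 : ∀ x, ‖Φ x‖ ≤ 1)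
    (hΦ : D.extend (fun s => Φ (D.incl s)) Φ = Φ)
    (hs : IsSpherical fun s => Φ (D.incl s)) (a b : ZEllOne G) :
    pairing Φ (D.trunc a * b : ZEllOne G)
      = pairing Φ (D.trunc a : EllOne G) * pairing Φ (b : EllOne G) := by
  have h1 := D.pairing_sum_smul_delta_mul_extend (b := fun s => Φ (D.incl s))
    (b' := fun s => Φ (D.incl s)) (by rw [hΦ]; exact hΦ1)
    (hs.sum_mul_apply_mul (w := fun s => (a : EllOne G) (D.incl s)) (D.apply_incl_conj a))
    (b : EllOne G)
  rw [hΦ] at h1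
  rw [Subalgebra.coe_mul, coe_trunc, h1, pairing_sum hΦ1]
  simp only [pairing_smul, pairing_delta]

theorem pairing_idem (hΦ1 : ∀ x, ‖Φ x‖ ≤ 1)
    (hs : IsSpherical fun s => Φ (D.incl s)) :
    pairing Φ (D.idem (fun s => Φ (D.incl s)) : EllOne G) = 1 := by
  have hN : (sumSq fun s => Φ (D.incl s) : ℂ) ≠ 0 := by exact_mod_cast hs.sumSq_pos.ne'
  rw [D.coe_idem hs, pairing_sum hΦ1]
  simp only [pairing_smul, pairing_delta, div_mul_eq_mul_div, ← Finset.sum_div]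
  rw [div_eq_one_iff_eq hN, ofReal_sumSq]
  simp only [mul_comm]

/-- Pairing with the phase of `Φ` on `K` detects the full norm of the idempotent. -/
theorem mul_norm_pairing_le (hΦ1 : ∀ x, ‖Φ x‖ ≤ 1)
    (hΦ : D.extend (fun s => Φ (D.incl s)) Φ = Φ)
    (hs : IsSpherical fun s => Φ (D.incl s)) (f : EllOne G) :
    (∑ s, ‖Φ (D.incl s)‖) / (sumSq fun s => Φ (D.incl s)) * ‖pairing Φ f‖
      ≤ ‖(D.idem (fun s => Φ (D.incl s)) : EllOne G) * f‖ := by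
  have hN := hs.sumSq_pos
  have hNC : (sumSq fun s => Φ (D.incl s) : ℂ) ≠ 0 := by exact_mod_cast hN.ne'
  -- the phase of `Φ`; it is `0 / 0 = 0` where `Φ` vanishes
  let b : K → ℂ := fun s => Φ (D.incl s) / ‖Φ (D.incl s)‖
  have hb1 : ∀ s, ‖b s‖ ≤ 1 := fun s => by
    simp only [b, norm_div, Complex.norm_real, norm_norm]
    exact div_self_le_one _
  have hbc : ∀ g h, b (g * h * g⁻¹) = b h := fun g h => by
    simp only [b, hs.apply_conj g h]
  have hB : ∀ x, ‖D.extend b Φ x‖ ≤ 1 := fun x => by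
    rw [extend, norm_mul]
    exact mul_le_one₀ (hb1 _) (norm_nonneg _) (hΦ1 _)
  have hsum : ∑ s, conj (Φ (D.incl s)) * b s = ((∑ s, ‖Φ (D.incl s)‖ : ℝ) : ℂ) := by
    push_cast
    refine Finset.sum_congr rfl fun s _ => ?_
    simp only [b]
    rw [← mul_div_assoc, mul_comm, Complex.mul_conj, Complex.normSq_eq_norm_sq]
    by_cases h0 : ‖Φ (D.incl s)‖ = 0
    · simp [h0]
    · have : (‖Φ (D.incl s)‖ : ℂ) ≠ 0 := by exact_mod_cast h0
      push_cast
      field_simp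
  have h1 := D.pairing_sum_smul_delta_mul_extend hB
    (w := fun s => conj (Φ (D.incl s)) / (sumSq fun s => Φ (D.incl s)))
    (c := ((∑ s, ‖Φ (D.incl s)‖ : ℝ) : ℂ) / (sumSq fun s => Φ (D.incl s)))
    (b' := fun s => Φ (D.incl s))
    (fun t => by
      simp only [div_mul_eq_mul_div, ← Finset.sum_div]
      rw [hs.sum_conj_mul_apply_mul hbc t, hsum]) f
  rw [hΦ, ← D.coe_idem hs] at h1
  have h2 := norm_pairing_le hB ((D.idem (fun s => Φ (D.incl s)) : EllOne G) * f)
  rw [h1, norm_mul, norm_div, Complex.norm_real, Complex.norm_real, Real.norm_of_nonneg hN.le,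
    Real.norm_of_nonneg (Finset.sum_nonneg fun _ _ => norm_nonneg _)] at h2
  exact h2

end DirectFactor
end

/-! ### Approximate identities from bounded idempotents -/

noncomputable section

open ComplexConjugate EllOne

section RestrictedProduct

variable {ι : Type u} {G : ι → Type v} [∀ i, Group (G i)]

open Classical in
/-- The product of the factors indexed by a finite set `T`, as a direct factor of the restricted
direct product. -/
def directFactor (G : ι → Type v) [∀ i, Group (G i)] (T : Finset ι) :
    DirectFactor (restrictedDirectProduct G) (∀ i : T, G i) where
  incl :=
    { toFun := fun x => ⟨fun i => if h : i ∈ T then x ⟨i, h⟩ else 1,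
        T.finite_toSet.subset fun i hi => by
          by_contra h
          exact hi (dif_neg h)⟩
      map_one' := by
        ext i
        simp
      map_mul' := fun x y => by
        ext i
        by_cases h : i ∈ T <;> simp [h] }
  proj :=
    { toFun := fun x i => x.1 i
      map_one' := rfl
      map_mul' := fun _ _ => rfl }
  proj_incl k := by
    ext i
    simp
  conj_incl g k := by
    ext i
    by_cases h : i ∈ T <;> simp [h]

open Classical in
theorem directFactor_incl_apply (T : Finset ι) (k : ∀ i : T, G i) (i : ι) :
    ((directFactor G T).incl k).1 i = if h : i ∈ T then k ⟨i, h⟩ else 1 := rfl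

theorem directFactor_proj_apply (T : Finset ι) (x : restrictedDirectProduct G) (i : T) :
    (directFactor G T).proj x i = x.1 i := rfl

theorem mem_range_incl_iff {T : Finset ι} {x : restrictedDirectProduct G} :
    x ∈ Set.range (directFactor G T).incl ↔ ∀ i ∉ T, x.1 i = 1 := by
  constructor
  · rintro ⟨k, rfl⟩ i hi
    rw [directFactor_incl_apply, dif_neg hi]
  · intro h
    refine ⟨(directFactor G T).proj x, ?_⟩
    ext i
    rw [directFactor_incl_apply]
    split_ifs with hi
    · rfl
    · exact (h i hi).symm

theorem exists_mem_range_incl (x : restrictedDirectProduct G) :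
    ∃ T : Finset ι, x ∈ Set.range (directFactor G T).incl := by
  refine ⟨Set.Finite.toFinset x.2, mem_range_incl_iff.2 fun i hi => ?_⟩
  by_contra h
  exact hi ((Set.Finite.mem_toFinset _).2 h)

variable [DecidableEq ι] [∀ i, Fintype (G i)]

/-- Central elements of `ℓ¹(⨁ Gᵢ)` are approximated by their restrictions to finite
subproducts. -/
theorem tendsto_trunc (a : ZEllOne (restrictedDirectProduct G)) :
    Tendsto (fun T => (directFactor G T).trunc a) atTop (𝓝 a) := by
  classical
  rw [tendsto_subtype_rng]
  -- the restriction to a subproduct is a partial sum of `∑ a x • delta x`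
  let S : Finset ι → Finset (restrictedDirectProduct G) := fun T =>
    Finset.univ.image (directFactor G T).incl
  have hmem : ∀ T x, x ∈ S T ↔ ∀ i ∉ T, x.1 i = 1 := fun T x => by
    rw [← mem_range_incl_iff]
    simp [S]
  have hS : Tendsto S atTop atTop := by
    refine tendsto_atTop_finset_of_monotone (fun T T' h x hx => ?_) fun x => ?_
    · rw [hmem] at hx ⊢
      exact fun i hi => hx i fun h' => hi (h h')
    · obtain ⟨T, hT⟩ := exists_mem_range_incl x
      exact ⟨T, (hmem T x).2 (mem_range_incl_iff.1 hT)⟩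
  refine ((hasSum_smul_delta (a : EllOne (restrictedDirectProduct G))).comp hS).congr fun T => ?_
  rw [DirectFactor.coe_trunc, Function.comp_apply, Finset.sum_image]
  exact fun x _ y _ h => by
    have := congrArg (directFactor G T).proj h
    simpa only [DirectFactor.proj_incl] using this

/-- If the idempotents attached to the restrictions of a character of `Zℓ¹(⨁ Gᵢ)` to finite
subproducts are bounded, then their complements are an approximate identity of its kernel. -/
theorem hasBAIOfNormLE_ker {C : ℝ} (ω : ZEllOne (restrictedDirectProduct G) →ₐ[ℂ] ℂ)
    (hω : Continuous ω)
    (hC : ∀ T, ‖(directFactor G T).idem fun s => ω ((directFactor G T).classAvg s)‖ ≤ C) :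
    HasBAIOfNormLE (RingHom.ker ω) (1 + C) := by
  set e : Finset ι → ZEllOne (restrictedDirectProduct G) := fun T =>
    (directFactor G T).idem fun s => ω ((directFactor G T).classAvg s) with he
  have key : ∀ a, ω a = 0 → Tendsto (fun T => e T * a) atTop (𝓝 0) := by
    intro a ha
    have h1 : Tendsto (fun T => C * ‖a - (directFactor G T).trunc a‖
        + ‖ω ((directFactor G T).trunc a)‖ * C) atTop (𝓝 0) := by
      have h2 : Tendsto (fun T => ‖a - (directFactor G T).trunc a‖) atTop (𝓝 0) := by
        have := (tendsto_const_nhds (x := a)).sub (tendsto_trunc a)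
        rw [sub_self] at this
        simpa using this.norm
      have h3 : Tendsto (fun T => ‖ω ((directFactor G T).trunc a)‖) atTop (𝓝 0) := by
        have := ((hω.tendsto a).comp (tendsto_trunc a)).norm
        rw [ha, norm_zero] at this
        exact this
      simpa using (h2.const_mul C).add (h3.mul_const C)
    refine squeeze_zero_norm (fun T => ?_) h1
    have h4 : e T * a = e T * (a - (directFactor G T).trunc a)
        + ω ((directFactor G T).trunc a) • e T := by
      rw [← (directFactor G T).trunc_mul_idem ω a, mul_comm ((directFactor G T).trunc a)]
      have h5 : e T * (a - (directFactor G T).trunc a) = e T * a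
          - e T * (directFactor G T).trunc a :=
        mul_sub _ _ _
      rw [h5]
      exact (sub_add_cancel _ _).symm
    rw [h4]
    refine (norm_add_le _ _).trans (add_le_add ((norm_mul_le _ _).trans ?_) ?_)
    · exact mul_le_mul_of_nonneg_right (hC T) (norm_nonneg _)
    · rw [norm_smul]
      exact mul_le_mul_of_nonneg_left (hC T) (norm_nonneg _)
  have key' : ∀ a, ω a = 0 → Tendsto (fun T => (1 - e T) * a) atTop (𝓝 a) := by
    intro a ha
    have := (tendsto_const_nhds (x := a)).sub (key a ha)
    rw [sub_zero] at this
    exact this.congr fun T => (one_sub_mul (e T) a).symm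
  refine ⟨map (fun T => 1 - e T) atTop, inferInstance, ?_, fun a ha => ?_⟩
  · rw [eventually_map]
    refine Eventually.of_forall fun T => ⟨?_, ?_⟩
    · rw [RingHom.mem_ker, map_sub, map_one, he]
      simp only [DirectFactor.apply_idem, sub_self]
    · refine (norm_sub_le _ _).trans (add_le_add (le_of_eq ?_) (hC T))
      exact norm_one_eq
  · have ha' : ω a = 0 := ha
    rw [tendsto_map'_iff, tendsto_map'_iff]
    refine ⟨key' a ha', (key' a ha').congr fun T => ?_⟩
    exact mul_comm _ _

end RestrictedProduct

section Characters

theorem IsSpherical.one_le_sumSq {K : Type*} [Group K] [Fintype K] {φ : K → ℂ}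
    (hφ : IsSpherical φ) : 1 ≤ sumSq φ := by
  have := Finset.single_le_sum (f := fun x => ‖φ x‖ ^ 2) (fun _ _ => by positivity)
    (Finset.mem_univ (1 : K))
  simpa [hφ.map_one, sumSq] using this

theorem IsSpherical.sum_norm_div_sumSq_le {K : Type*} [Group K] [Fintype K] {φ : K → ℂ}
    (hφ : IsSpherical φ) : (∑ x, ‖φ x‖) / sumSq φ ≤ Fintype.card K := by
  refine (div_le_self (Finset.sum_nonneg fun _ _ => norm_nonneg _) hφ.one_le_sumSq).trans ?_
  have := Finset.sum_le_sum fun x (_ : x ∈ Finset.univ) => hφ.norm_le_one x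
  simpa using this

variable {ι : Type u} [DecidableEq ι] {G : ι → Type v} [∀ i, Group (G i)] [∀ i, Fintype (G i)]

/-- The norms of all central idempotents of finite subproducts are bounded, if those of almost all
factors are one. -/
theorem norm_idem_directFactor_le {F : Finset ι}
    (hF : ∀ i ∉ F, ∀ φ : G i → ℂ, IsSpherical φ → ∑ x, ‖φ x‖ = sumSq φ) (T : Finset ι)
    {φ : (∀ i : T, G i) → ℂ} (hφ : IsSpherical φ) :
    ‖(directFactor G T).idem φ‖ ≤ ∏ i ∈ F, Fintype.card (G i) := by
  classical
  refine ((directFactor G T).norm_idem_le hφ).trans ?_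
  have h1 : φ = fun x => ∏ i, φ (Pi.mulSingle i (x i)) := funext hφ.eq_prod
  have hi := hφ.comp_mulSingle
  have h2 : (∑ x, ‖φ x‖) / sumSq φ = ∏ i : T, (∑ x, ‖φ (Pi.mulSingle i x)‖)
      / sumSq fun x => φ (Pi.mulSingle i x) := by
    conv_lhs => rw [h1]
    rw [sum_norm_pi fun i x => φ (Pi.mulSingle i x), sumSq_pi fun i x => φ (Pi.mulSingle i x),
      Finset.prod_div_distrib]
  rw [h2]
  calc _ ≤ ∏ i : T, (if (i : ι) ∈ F then (Fintype.card (G i) : ℝ) else 1) := by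
        refine Finset.prod_le_prod (fun i _ => div_nonneg
          (Finset.sum_nonneg fun _ _ => norm_nonneg _) (hi i).sumSq_pos.le) fun i _ => ?_
        split_ifs with h
        · exact (hi i).sum_norm_div_sumSq_le
        · rw [hF i h _ (hi i), div_self (hi i).sumSq_pos.ne']
    _ = ((∏ i ∈ T with i ∈ F, Fintype.card (G i) : ℕ) : ℝ) := by
        rw [Finset.prod_coe_sort T fun i => if i ∈ F then (Fintype.card (G i) : ℝ) else 1,
          Finset.prod_filter]
        push_cast
        rfl
    _ ≤ _ := by
        refine Nat.cast_le.2 (Nat.le_of_dvd (Finset.prod_pos fun i _ => Fintype.card_pos) ?_)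
        exact Finset.prod_dvd_prod_of_subset _ _ _ fun i hi => (Finset.mem_filter.1 hi).2

theorem hasBAIOfNormLE_of_isMaximal {F : Finset ι}
    (hF : ∀ i ∉ F, ∀ φ : G i → ℂ, IsSpherical φ → ∑ x, ‖φ x‖ = sumSq φ)
    (I : Ideal (ZEllOne (restrictedDirectProduct G))) (hI : I.IsMaximal) :
    HasBAIOfNormLE I (1 + ∏ i ∈ F, Fintype.card (G i)) := by
  let ω : ZEllOne (restrictedDirectProduct G) →ₐ[ℂ] ℂ :=
    WeakDual.CharacterSpace.equivAlgHom I.toCharacterSpace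
  have hker : RingHom.ker ω = I := by
    refine (hI.eq_of_le (RingHom.ker_ne_top _) fun a ha => ?_).symm
    exact I.toCharacterSpace_apply_eq_zero_of_mem ha
  rw [← hker]
  have hω : Continuous ω := map_continuous I.toCharacterSpace
  refine hasBAIOfNormLE_ker ω hω fun T => ?_
  exact norm_idem_directFactor_le hF T ((directFactor G T).isSpherical_comp_classAvg ω)

end Characters
end

/-! ### Product characters -/

noncomputable section

open ComplexConjugate EllOne

theorem mul_one_sub_eq {R : Type*} [CommRing R] (e a : R) :
    e * (1 - a) = (1 - a) + (a * (1 - e) - (1 - e)) := by ring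

namespace EllOne

theorem continuous_pairing {H : Type*} {B : H → ℂ} (hB : ∀ x, ‖B x‖ ≤ 1) :
    Continuous (pairing B) :=
  ((⟨⟨pairing B, pairing_add hB⟩, pairing_smul⟩ : EllOne H →ₗ[ℂ] ℂ).mkContinuous 1 fun f => by
    rw [one_mul]
    exact norm_pairing_le hB f).continuous

end EllOne

section ProductCharacter

variable {ι : Type u} {G : ι → Type v} [∀ i, Group (G i)]

/-- The product of functions on the factors, as a function on the restricted direct product. -/
def prodFun (φ : ∀ i, G i → ℂ) (x : restrictedDirectProduct G) : ℂ := ∏ᶠ i, φ i (x.1 i)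

variable {φ : ∀ i, G i → ℂ}

theorem prodFun_incl (hφ : ∀ i, φ i 1 = 1) (T : Finset ι) (s : ∀ i : T, G i) :
    prodFun φ ((directFactor G T).incl s) = ∏ i : T, φ i (s i) := by
  rw [prodFun, finprod_eq_prod_of_mulSupport_subset (s := T), ← Finset.prod_coe_sort]
  · refine Finset.prod_congr rfl fun i _ => ?_
    rw [directFactor_incl_apply, dif_pos i.2]
  · intro i hi
    by_contra h
    refine hi ?_
    change φ i (((directFactor G T).incl s).1 i) = 1
    rw [directFactor_incl_apply, dif_neg (by simpa using h), hφ]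

/-- The product function splits along every finite subproduct. -/
theorem extend_prodFun (hφ : ∀ i, φ i 1 = 1) (T : Finset ι) :
    (directFactor G T).extend (fun s => prodFun φ ((directFactor G T).incl s)) (prodFun φ)
      = prodFun φ := by
  funext x
  have hfin : ∀ y : restrictedDirectProduct G,
      (Function.mulSupport fun i => φ i (y.1 i)).Finite := fun y =>
    Set.Finite.subset y.2 fun i hi h => hi (by simp [h, hφ])
  rw [DirectFactor.extend, prodFun, prodFun, prodFun,
    ← finprod_mul_distrib (hfin _) (hfin _)]
  refine finprod_congr fun i => ?_
  simp only [Subgroup.coe_mul, Subgroup.coe_inv, Pi.mul_apply, Pi.inv_apply,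
    directFactor_incl_apply]
  split_ifs with h
  · simp [directFactor_proj_apply, hφ]
  · simp [hφ]

variable [∀ i, Fintype (G i)]

theorem pairing_prodFun_one (hφ : ∀ i, IsSpherical (φ i)) :
    pairing (prodFun φ) (1 : EllOne (restrictedDirectProduct G)) = 1 := by
  rw [← delta_one (G := restrictedDirectProduct G), pairing_delta, prodFun]
  exact finprod_eq_one_of_forall_eq_one fun i => (hφ i).map_one

variable [DecidableEq ι]

theorem isSpherical_prodFun_incl (hφ : ∀ i, IsSpherical (φ i)) (T : Finset ι) :
    IsSpherical fun s => prodFun φ ((directFactor G T).incl s) := by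
  simp only [prodFun_incl fun i => (hφ i).map_one]
  exact IsSpherical.pi fun i => hφ i

theorem norm_prodFun_le_one (hφ : ∀ i, IsSpherical (φ i)) (x : restrictedDirectProduct G) :
    ‖prodFun φ x‖ ≤ 1 := by
  obtain ⟨T, s, rfl⟩ := exists_mem_range_incl x
  exact (isSpherical_prodFun_incl hφ T).norm_le_one s

/-- Pairing with a product of spherical functions is multiplicative on the centre, as a limit of the
corresponding statement for restrictions to finite subproducts. -/
theorem pairing_prodFun_mul (hφ : ∀ i, IsSpherical (φ i))
    (a b : ZEllOne (restrictedDirectProduct G)) :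
    pairing (prodFun φ) (a * b : EllOne (restrictedDirectProduct G))
      = pairing (prodFun φ) (a : EllOne (restrictedDirectProduct G))
        * pairing (prodFun φ) (b : EllOne (restrictedDirectProduct G)) := by
  have hc := continuous_pairing (norm_prodFun_le_one hφ)
  have ht : Tendsto (fun T => ((directFactor G T).trunc a : EllOne (restrictedDirectProduct G)))
      atTop (𝓝 (a : EllOne (restrictedDirectProduct G))) := tendsto_subtype_rng.1 (tendsto_trunc a)
  have h1 := ((hc.tendsto _).comp ht).mul_const
    (pairing (prodFun φ) (b : EllOne (restrictedDirectProduct G)))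
  have h2 := (hc.tendsto _).comp (ht.mul_const (b : EllOne (restrictedDirectProduct G)))
  refine tendsto_nhds_unique h2 (h1.congr fun T => ?_)
  exact ((directFactor G T).pairing_trunc_mul (norm_prodFun_le_one hφ)
    (extend_prodFun (fun i => (hφ i).map_one) T) (isSpherical_prodFun_incl hφ T) a b).symm

/-- The character of `Zℓ¹(⨁ Gᵢ)` attached to a family of normalised irreducible characters of the
factors. -/
def prodChar (hφ : ∀ i, IsSpherical (φ i)) : ZEllOne (restrictedDirectProduct G) →ₐ[ℂ] ℂ :=
  AlgHom.ofLinearMap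
    { toFun := fun a => pairing (prodFun φ) (a : EllOne (restrictedDirectProduct G))
      map_add' := fun _ _ => pairing_add (norm_prodFun_le_one hφ) _ _
      map_smul' := fun c _ => pairing_smul c _ }
    (pairing_prodFun_one hφ) (pairing_prodFun_mul hφ)

theorem prodChar_apply (hφ : ∀ i, IsSpherical (φ i)) (a : ZEllOne (restrictedDirectProduct G)) :
    prodChar hφ a = pairing (prodFun φ) (a : EllOne (restrictedDirectProduct G)) := rfl

theorem isMaximal_ker_prodChar (hφ : ∀ i, IsSpherical (φ i)) :
    (RingHom.ker (prodChar hφ)).IsMaximal :=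
  RingHom.ker_isMaximal_of_surjective _ fun c =>
    ⟨algebraMap ℂ _ c, AlgHom.commutes (prodChar hφ) c⟩

/-- A bounded approximate identity in the kernel of a product character bounds the norms of the
idempotents of all finite subproducts. -/
theorem prod_le_of_hasBAIOfNormLE (hφ : ∀ i, IsSpherical (φ i)) {M : ℝ}
    (h : HasBAIOfNormLE (RingHom.ker (prodChar hφ)) M) (T : Finset ι) :
    ∏ i ∈ T, (∑ x, ‖φ i x‖) / sumSq (φ i) ≤ M + 2 := by
  obtain ⟨l, hl, hlM, hlt⟩ := h
  set e := (directFactor G T).idem fun s => prodFun φ ((directFactor G T).incl s) with he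
  have hΦ1 := norm_prodFun_le_one hφ
  have hs := isSpherical_prodFun_incl hφ T
  have hext := extend_prodFun (fun i => (hφ i).map_one) T
  have hωe : prodChar hφ e = 1 := (directFactor G T).pairing_idem hΦ1 hs
  have hmem : 1 - e ∈ RingHom.ker (prodChar hφ) := by
    rw [RingHom.mem_ker, map_sub, map_one, hωe, sub_self]
  have h1 := (hlt _ hmem).1
  rw [tendsto_iff_norm_sub_tendsto_zero] at h1
  obtain ⟨a, ⟨ha, haM⟩, ha1⟩ := (hlM.and (h1.eventually (gt_mem_nhds one_pos))).exists
  have ha0 : prodChar hφ a = 0 := ha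
  have h2 := (directFactor G T).mul_norm_pairing_le hΦ1 hext hs
    ((1 - a : ZEllOne _) : EllOne (restrictedDirectProduct G))
  rw [← prodChar_apply hφ, map_sub, map_one, ha0, sub_zero, norm_one, mul_one] at h2
  have h3 : ‖e * (1 - a)‖ ≤ M + 2 := by
    have h4 : e * (1 - a) = (1 - a) + (a * (1 - e) - (1 - e)) := mul_one_sub_eq e a
    rw [h4]
    have h5 : ‖(1 : ZEllOne (restrictedDirectProduct G))‖ = 1 := norm_one_eq
    have h6 := norm_add_le (1 - a) (a * (1 - e) - (1 - e))
    have h7 := norm_sub_le 1 a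
    linarith
  have h8 : ∏ i ∈ T, (∑ x, ‖φ i x‖) / sumSq (φ i)
      = (∑ s, ‖prodFun φ ((directFactor G T).incl s)‖)
        / sumSq fun s => prodFun φ ((directFactor G T).incl s) := by
    simp only [prodFun_incl fun i => (hφ i).map_one]
    rw [sum_norm_pi fun (i : T) x => φ i x, sumSq_pi fun (i : T) x => φ i x,
      ← Finset.prod_div_distrib, Finset.prod_coe_sort T fun i => (∑ x, ‖φ i x‖) / sumSq (φ i)]
  rw [h8]
  exact h2.trans h3

end ProductCharacter

theorem isSpherical_one {K : Type*} [Group K] [Fintype K] : IsSpherical fun _ : K => (1 : ℂ) where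
  map_one := rfl
  sum_conj x y := by simp

/-- If every maximal ideal has a bounded approximate identity, then almost all factors have only
minimal central idempotents of norm one. -/
theorem finite_setOf_sum_norm_ne {ι : Type u} {G : ι → Type v} [∀ i, Group (G i)]
    [∀ i, Fintype (G i)]
    (h : ∀ I : Ideal (ZEllOne (restrictedDirectProduct G)), I.IsMaximal → HasBAI I) :
    {i | ∃ φ : G i → ℂ, IsSpherical φ ∧ ∑ x, ‖φ x‖ ≠ sumSq φ}.Finite := by
  classical
  by_contra hinf
  -- a witness of norm greater than one for the bad indices, the trivial character for the others
  have hch : ∀ i, ∃ φ : G i → ℂ, IsSpherical φ ∧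
      ((∃ φ : G i → ℂ, IsSpherical φ ∧ ∑ x, ‖φ x‖ ≠ sumSq φ) → ∑ x, ‖φ x‖ ≠ sumSq φ) := by
    intro i
    by_cases hi : ∃ φ : G i → ℂ, IsSpherical φ ∧ ∑ x, ‖φ x‖ ≠ sumSq φ
    · obtain ⟨φ, h1, h2⟩ := hi
      exact ⟨φ, h1, fun _ => h2⟩
    · exact ⟨fun _ => 1, isSpherical_one, fun h => absurd h hi⟩
  choose φ hφ hbad using hch
  obtain ⟨M, hM⟩ := h _ (isMaximal_ker_prodChar hφ)
  obtain ⟨n, hn⟩ := pow_unbounded_of_one_lt (M + 2) (show (1 : ℝ) < 1 + 1 / 800 by norm_num)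
  obtain ⟨T, hT, hTn⟩ := Set.Infinite.exists_subset_card_eq hinf n
  have h1 := prod_le_of_hasBAIOfNormLE hφ hM T
  have h2 : (1 + 1 / 800 : ℝ) ^ n ≤ ∏ i ∈ T, (∑ x, ‖φ i x‖) / sumSq (φ i) := by
    rw [← hTn, ← Finset.prod_const]
    refine Finset.prod_le_prod (fun _ _ => by norm_num) fun i hi => ?_
    rw [le_div_iff₀ (hφ i).sumSq_pos]
    exact (hφ i).sum_norm_eq_or_le.resolve_left (hbad i (hT hi))
  linarith

end

theorem theoremt {ι : Type u} (G : ι → Type v) [∀ i, Group (G i)] [∀ i, Fintype (G i)] :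
    List.TFAE [
      ∀ I : Ideal (ZEllOne (restrictedDirectProduct G)), I.IsMaximal → HasBAI I,
      ∃ F : Finset ι, ∀ i, i ∉ F → ∀ (d : ℕ) (χ : G i → ℂ), IsIrreducibleCharacter d χ →
        (d : ℝ) * ∑ x, ‖χ x‖ = (Fintype.card (G i) : ℝ),
      ∃ M : ℝ, 0 < M ∧ ∀ I : Ideal (ZEllOne (restrictedDirectProduct G)), I.IsMaximal →
        HasBAIOfNormLE I M] := by
  classical
  tfae_have 1 → 2 := by
    intro h
    refine ⟨(finite_setOf_sum_norm_ne h).toFinset, fun i hi d χ hχ => ?_⟩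
    rw [hχ.mul_sum_norm_eq_iff]
    by_contra hne
    exact hi ((Set.Finite.mem_toFinset _).2 ⟨_, hχ.isSpherical, hne⟩)
  tfae_have 2 → 3 := by
    rintro ⟨F, hF⟩
    refine ⟨1 + ∏ i ∈ F, Fintype.card (G i), by positivity, fun I hI => ?_⟩
    refine hasBAIOfNormLE_of_isMaximal (fun i hi φ hφ => ?_) I hI
    obtain ⟨d, χ, hχ, rfl⟩ := hφ.exists_isIrreducibleCharacter
    exact hχ.mul_sum_norm_eq_iff.1 (hF i hi d χ hχ)
  tfae_have 3 → 1 := fun ⟨M, _, hM⟩ I hI => ⟨M, hM I hI⟩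
  tfae_finish
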